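/- A standard Young tableau $T$ of size $n$ is a filling of the boxes of the Young diagram of a partition of $n$ by $1,2,\ldots,n$, each used once, increasing along rows (left to right) and down columns. For $1\le j\le n$ let $r_j(T)$ be the number of the row containing $j$ (row $1$ is the top row), and let $T_{<j}$ be the subtableau occupied by the entries $1,\ldots,j-1$. The tableau $T$ is a Richardson tableau if for every $1\le j\le n$ with $r_j(T)\ge 2$, the largest entry of $T_{<j}$ in row $r_j(T)-1$ is greater than every entry of $T_{<j}$ lying in or strictly below row $r_j(T)$. The evacuation $\mathrm{evac}(T)$ is defined as follows. Remove the entry $1$ from the upper left corner of $T$, decrease the remaining entries by $1$, and slide the empty box by repeatedly swapping it with the smaller of the entries directly to its right and directly below it, until neither exists. This gives a standard tableau $\Delta(T)$ of size $n-1$; the box of $T$ that is not in $\Delta(T)$ receives the entry $n$ in $\mathrm{evac}(T)$. Doing the same with $\Delta(T)$ places $n-1$, and so on, until all boxes are filled with $n,n-1,\ldots,1$. Let $M_j$ be the $j$-th Motzkin number, that is, the number of lattice paths from $(0,0)$ to $(j,0)$ with steps $(1,1)$, $(1,-1)$ and $(1,0)$ that never go strictly below the $x$-axis (so $M_0=1$).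 **Theorem.** For every integer $n\ge 0$, the number of Richardson tableaux $T$ of size $n$ with $\mathrm{evac}(T)=T$ is equal to $$M_{\lfloor n/2\rfloor}+\sum_{k\ge 1}\ \sum_{1\le i_1<\cdots<i_k\le \lfloor n/2\rfloor}\ \prod_{p=1}^{k+1} M_{i_p-i_{p-1}-1},$$ where $i_0=0$ and $i_{k+1}=\lfloor n/2\rfloor+1$. -/

import Mathlib

/-- A standard Young tableau of size `n`: a Young diagram with `n` boxes, filled so that rows
weakly increase, columns strictly increase, and the integers appearing are exactly `1, …, n`
(so each appears once). Rows and columns are indexed from `0`, row `0` being the top row. -/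
structure StandardTableau (n : ℕ) where
  shape : YoungDiagram
  card_shape : shape.card = n
  tab : SemistandardYoungTableau shape
  entries : shape.cells.image (fun c => tab c.1 c.2) = Finset.Icc 1 n

namespace StandardTableau

/-- The filling of the plane given by a standard tableau: the entry of a box of the shape,
and `0` for a position outside the shape. -/
def filling {n : ℕ} (T : StandardTableau n) : ℕ × ℕ → ℕ := fun c => T.tab c.1 c.2

/-- The boxes of the row `i` of `T` whose entries are smaller than `j`. -/
def rowBelow {n : ℕ} (T : StandardTableau n) (i j : ℕ) : Finset (ℕ × ℕ) :=
  (T.shape.row i).filter (fun c => T.filling c < j)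

/-- The Richardson condition. For every box `c` that is not in the top row, with entry `j`, the
largest entry among the entries smaller than `j` in the row just above `c` is greater than every
entry smaller than `j` that lies in the row of `c` or strictly below it. (The set over which the
maximum is taken is never empty: it contains the box just above `c`.) -/
def IsRichardson {n : ℕ} (T : StandardTableau n) : Prop :=
  ∀ c ∈ T.shape, 1 ≤ c.1 →
    ∀ d ∈ T.shape, c.1 ≤ d.1 → T.filling d < T.filling c →
      T.filling d < (T.rowBelow (c.1 - 1) (T.filling c)).sup T.filling

end StandardTableau

/-- One jeu de taquin move of an empty box located at `c`, in a filling `f` whose value is `0` at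
the positions that are not boxes: among the boxes directly to the right of `c` and directly below
`c`, the empty box moves to the one with the smaller entry; it stays at `c` if there are none. -/
def slideNext (f : ℕ × ℕ → ℕ) (c : ℕ × ℕ) : ℕ × ℕ :=
  if f (c.1, c.2 + 1) = 0 ∧ f (c.1 + 1, c.2) = 0 then c
  else if f (c.1 + 1, c.2) = 0 ∨ (f (c.1, c.2 + 1) ≠ 0 ∧ f (c.1, c.2 + 1) < f (c.1 + 1, c.2)) then
    (c.1, c.2 + 1)
  else (c.1 + 1, c.2)

/-- The position of the empty box after `k` moves, starting from the upper left corner. (The boxes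
to the right of and below the empty box have not been changed by the earlier moves, so the moves
can be read off the original filling.) -/
def slidePos (f : ℕ × ℕ → ℕ) (k : ℕ) : ℕ × ℕ := (slideNext f)^[k] (0, 0)

/-- The corner where the empty box stops, for a tableau `f` with `m` boxes: after `m` moves it has
certainly stopped. -/
def slideEnd (m : ℕ) (f : ℕ × ℕ → ℕ) : ℕ × ℕ := slidePos f m

/-- The tableau `Δ(f)`, for a tableau `f` with `m` boxes: the entry `1` is removed from the upper
left corner, the other entries are decreased by `1`, and the empty box is slid to a corner. A box
left by the empty box receives the entry of the box to which the empty box moves next, and the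
corner where it stops is no longer a box. -/
def slideDelta (m : ℕ) (f : ℕ × ℕ → ℕ) : ℕ × ℕ → ℕ := fun c =>
  if c = slideEnd m f then 0
  else if c ∈ (Finset.range m).image (slidePos f) then f (slideNext f c) - 1
  else f c - 1

/-- Evacuation of a tableau `f` with `m` boxes: `m` is put in the corner vacated when passing from
`f` to `Δ(f)`, and the other boxes are filled by evacuation of `Δ(f)`, which has `m - 1` boxes. -/
def evacFilling : ℕ → (ℕ × ℕ → ℕ) → (ℕ × ℕ → ℕ)
  | 0, _ => fun _ => 0
  | m + 1, f => fun c =>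
      if c = slideEnd (m + 1) f then m + 1 else evacFilling m (slideDelta (m + 1) f) c

/-- `T` is fixed by evacuation: `evac(T) = T`. -/
def StandardTableau.IsEvacFixed {n : ℕ} (T : StandardTableau n) : Prop :=
  evacFilling n T.filling = T.filling

/-- The height of a path with steps `s` after its first `k` steps; the steps are
`1` (up), `-1` (down) and `0` (horizontal). -/
def pathHeight {n : ℕ} (s : Fin n → SignType) (k : ℕ) : ℤ :=
  ∑ i : Fin n, if (i : ℕ) < k then (s i : ℤ) else 0

/-- The Motzkin number `M_n`: the number of paths from `(0, 0)` to `(n, 0)` with steps `(1, 1)`,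
`(1, -1)` and `(1, 0)` that never go strictly below the horizontal axis. -/
def motzkin (n : ℕ) : ℕ :=
  (Finset.univ.filter (fun s : Fin n → SignType =>
    (∀ k : Fin (n + 1), 0 ≤ pathHeight s k) ∧ pathHeight s n = 0)).card

/-- The sequences `0 = i_0 < i_1 < ⋯ < i_k < i_{k+1} = m + 1` of integers, that is, the choices of
`1 ≤ i_1 < ⋯ < i_k ≤ m` together with the conventions `i_0 = 0` and `i_{k+1} = m + 1`. -/
def indexChains (m k : ℕ) : Finset (Fin (k + 2) → Fin (m + 2)) :=
  Finset.univ.filter (fun i =>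
    i 0 = 0 ∧ i (Fin.last (k + 1)) = Fin.last (m + 1) ∧
      ∀ p : Fin (k + 1), i p.castSucc < i p.succ)

/-! ### Row words: deletion, evacuation and arches -/

namespace RowWord

/-! A standard tableau is encoded by the list of the rows of its entries `n, n - 1, …, 1`:
the head of the list is the row of the largest entry. -/

/-! Richardson tableaux and Motzkin paths have the same recursive structure, and evacuation becomes
reflection of the path. In the encoding by row words, a Richardson word factors uniquely into points
`[0]` and arches over Richardson words, just as a Motzkin path factors into flat steps and arches;
`MotzkinTree` indexes both (`word_injective`, `exists_word_eq`, `path_injective`, `exists_path_eq`).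

Removing 1 and sliding can be computed by recursion on the largest entry (`del`, justified by
`isSlide_fill`). This gives two rules: evacuation of a concatenation of lattice words evacuates the
factors and reverses their order (`evac_append`), and evacuation of an arch over `w` is the arch
over the evacuation of `w` (`evac_arch`). So evacuation reverses the tree (`evac_word`), that is,
reflects the path (`path_rev`), and the fixed Richardson tableaux of size n are as many as the
symmetric Motzkin paths of length n.

A symmetric path is determined by its second half, a path of length m = ⌊n/2⌋ from some height k to
0; for odd n the middle step is flat. The first passages to heights k-1, ..., 0 are down steps at
positions i_1 < ... < i_k, and they separate k+1 raised Motzkin paths of lengths i_p - i_{p-1} - 1.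
The term k = 0 is M_m, and the sum over k ≥ 1 is the double sum. -/

/-- The lattice condition: at every moment, no row is longer than the row above it. -/
def IsYam : List ℕ → Prop
  | [] => True
  | x :: w => IsYam w ∧ ∀ i, (x :: w).count (i + 1) ≤ (x :: w).count i

/-- The number of rows. -/
def height (w : List ℕ) : ℕ := w.toFinset.sup Nat.succ

/-- The row that loses a box when the smallest entry is removed and the hole is slid out,
together with the word of the remaining tableau. -/
def del : List ℕ → ℕ × List ℕ
  | [] => (0, [])
  | [x] => (x, [])
  | x :: y :: w =>
    let p := del (y :: w)
    -- The largest box lies directly below the vacated corner: next row, same column. If it lies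
    -- directly to the right, the hole also moves on, but no row changes, so the second branch
    -- applies.
    if x = p.1 + 1 ∧ (y :: w).count (p.1 + 1) + 1 = (y :: w).count p.1 then
      (p.1 + 1, p.1 :: p.2)
    else (p.1, x :: p.2)

/-- Evacuation of a word of length `m`. -/
def evac : ℕ → List ℕ → List ℕ
  | 0, _ => []
  | m + 1, w => (del w).1 :: evac m (del w).2

/-- Move the first box of every row one row down. -/
def raise : List ℕ → List ℕ
  | [] => []
  | x :: w => (if x ∈ w then x else x + 1) :: raise w

/-- The word of an arch over `w`. -/
def arch (w : List ℕ) : List ℕ := raise (height w :: w) ++ [0]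

/-- The Richardson condition for words. -/
def IsRich : List ℕ → Prop
  | [] => True
  | x :: w => IsRich w ∧ (x = 0 ∨ w.find? (fun y => decide (x ≤ y + 1)) = some (x - 1))

theorem IsYam.count_le {w : List ℕ} (h : IsYam w) (i : ℕ) : w.count (i + 1) ≤ w.count i := by
  cases w with
  | nil => simp
  | cons x w => exact h.2 i

theorem del_cons (x : ℕ) {w : List ℕ} (hw : w ≠ []) :
    del (x :: w) = if x = (del w).1 + 1 ∧ w.count ((del w).1 + 1) + 1 = w.count (del w).1 then
      ((del w).1 + 1, (del w).1 :: (del w).2) else ((del w).1, x :: (del w).2) := by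
  cases w with
  | nil => exact absurd rfl hw
  | cons y w => rfl

theorem count_del {w : List ℕ} (hw : w ≠ []) (i : ℕ) :
    w.count i = (del w).2.count i + if i = (del w).1 then 1 else 0 := by
  induction w with
  | nil => exact absurd rfl hw
  | cons x w ih =>
    by_cases h : w = []
    · subst h
      simp [del, List.count_singleton, eq_comm (a := i)]
    · have := ih h
      rw [del_cons x h, List.count_cons, this]
      simp only [beq_iff_eq]
      split_ifs <;> simp only [List.count_cons, beq_iff_eq] <;> split_ifs <;> omega

theorem length_del {w : List ℕ} (hw : w ≠ []) : (del w).2.length + 1 = w.length := by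
  induction w with
  | nil => exact absurd rfl hw
  | cons x w ih =>
    by_cases h : w = []
    · subst h
      simp [del]
    · have := ih h
      rw [del_cons x h]
      split_ifs <;> simp [this]

/-- The slide stops at a corner, so the row below is strictly shorter. -/
theorem IsYam.count_succ_lt {w : List ℕ} (h : IsYam w) (hw : w ≠ []) :
    w.count ((del w).1 + 1) < w.count (del w).1 := by
  induction w with
  | nil => exact absurd rfl hw
  | cons x w ih =>
    by_cases h' : w = []
    · subst h'
      simp [del]
    · have h1 := ih h.1 h'
      have h2 := h.1.count_le ((del w).1 + 1)
      rw [del_cons x h']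
      split_ifs with hc
      · obtain ⟨rfl, hc⟩ := hc
        simp only [List.count_cons]
        simp
        omega
      · simp only [List.count_cons]
        by_cases hx : x = (del w).1 + 1
        · have : w.count ((del w).1 + 1) + 1 ≠ w.count (del w).1 := fun h => hc ⟨hx, h⟩
          simp [hx]
          omega
        · simp [hx]
          omega

theorem IsYam.del {w : List ℕ} (h : IsYam w) (hw : w ≠ []) : IsYam (del w).2 := by
  induction w with
  | nil => exact absurd rfl hw
  | cons x w ih =>
    by_cases h' : w = []
    · subst h'
      simp [RowWord.del, IsYam]
    · have h1 := ih h.1 h'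
      have key : ∀ i, (RowWord.del (x :: w)).2.count (i + 1) ≤
          (RowWord.del (x :: w)).2.count i := by
        intro i
        have e1 := count_del hw i
        have e2 := count_del hw (i + 1)
        have e3 := h.count_le i
        have e4 := h.count_succ_lt hw
        split_ifs at e1 e2 with c1 c2 c2
        · omega
        · rw [← c1] at e4
          omega
        · omega
        · omega
      rw [del_cons x h'] at key ⊢
      split_ifs at key ⊢ with hc
      · exact ⟨h1, key⟩
      · exact ⟨h1, key⟩

/-- The slide row ρ of `w` is longer than row ρ + 1 by at least one. A letter ρ + 1 of `v` is
preceded in `v` by an additional ρ, so its box falls short of the column of the hole and is never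
pulled up. -/
theorem del_append {v w : List ℕ} (hv : IsYam v) (hw : IsYam w) (hn : w ≠ []) :
    del (v ++ w) = ((del w).1, v ++ (del w).2) := by
  induction v with
  | nil => rfl
  | cons x v ih =>
    rw [List.cons_append, del_cons x (by simp [hn]), ih hv.1, if_neg]
    · rfl
    · rintro ⟨hx, hc⟩
      have h1 := hv.2 (del w).1
      have h2 := hw.count_succ_lt hn
      simp only [List.count_append, List.count_cons, hx] at h1 hc
      simp at h1
      omega

theorem evac_append {w : List ℕ} (hw : IsYam w) {v : List ℕ} (hv : IsYam v) :
    evac (v ++ w).length (v ++ w) = evac w.length w ++ evac v.length v := by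
  induction h : w.length generalizing w with
  | zero =>
    rw [List.length_eq_zero_iff] at h
    subst h
    simp [evac]
  | succ m ih =>
    have hn : w ≠ [] := by rintro rfl; simp at h
    have hl := length_del hn
    have := ih (hw.del hn) (by omega)
    rw [List.length_append] at this
    rw [List.length_append, h, ← add_assoc, evac, del_append hv hw hn, evac, List.cons_append,
      ← this, show (del w).2.length = m by omega]

theorem count_evac {w : List ℕ} (i : ℕ) : (evac w.length w).count i = w.count i := by
  induction h : w.length generalizing w with
  | zero =>
    rw [List.length_eq_zero_iff] at h
    subst h
    simp [evac]
  | succ m ih =>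
    have hn : w ≠ [] := by rintro rfl; simp at h
    have hl := length_del hn
    rw [evac, List.count_cons, ih (by omega), count_del hn]
    simp [eq_comm (a := i)]

theorem mem_iff_of_count {v w : List ℕ} (h : ∀ i, v.count i = w.count i) (i : ℕ) :
    i ∈ v ↔ i ∈ w := by
  rw [← List.count_pos_iff, h, List.count_pos_iff]

theorem height_congr {v w : List ℕ} (h : ∀ i, i ∈ v ↔ i ∈ w) : height v = height w := by
  unfold height
  congr 1
  ext i
  simp [h]

theorem height_cons (x : ℕ) (w : List ℕ) : height (x :: w) = max (x + 1) (height w) := by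
  simp [height]

theorem lt_height {w : List ℕ} {i : ℕ} (h : i ∈ w) : i < height w :=
  Finset.le_sup (f := Nat.succ) (List.mem_toFinset.2 h)

/-- Restricted growth: every row that occurs is preceded by all rows above it. -/
def IsGrowth : List ℕ → Prop
  | [] => True
  | x :: w => IsGrowth w ∧ x ≤ height w

theorem IsGrowth.mem {w : List ℕ} (h : IsGrowth w) {i : ℕ} (hi : i < height w) : i ∈ w := by
  induction w with
  | nil => simp [height] at hi
  | cons x w ih =>
    rw [height_cons] at hi
    have := h.2
    by_cases hx : i = x
    · simp [hx]
    · exact List.mem_cons_of_mem _ (ih h.1 (by omega))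

theorem IsYam.isGrowth {w : List ℕ} (h : IsYam w) : IsGrowth w := by
  induction w with
  | nil => trivial
  | cons x w ih =>
    refine ⟨ih h.1, ?_⟩
    cases x with
    | zero => simp
    | succ x =>
      have := h.2 x
      simp only [List.count_cons] at this
      simp at this
      exact lt_height (List.count_pos_iff.1 (by omega))

theorem IsGrowth.eq_height {x : ℕ} {w : List ℕ} (h : IsGrowth (x :: w)) (hx : x ∉ w) :
    x = height w :=
  le_antisymm h.2 (not_lt.1 fun hl => hx (h.1.mem hl))

theorem IsYam.cons_height {w : List ℕ} (h : IsYam w) : IsYam (height w :: w) := by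
  refine ⟨h, fun i => ?_⟩
  have h1 := h.count_le i
  simp only [List.count_cons]
  by_cases hi : height w = i + 1
  · have : 0 < w.count i := List.count_pos_iff.2 (h.isGrowth.mem (by omega))
    have h0 : w.count (height w) = 0 :=
      List.count_eq_zero.2 fun hm => lt_irrefl _ (lt_height hm)
    rw [hi] at h0
    simp [hi]
    omega
  · simp [hi]
    omega

/-- The largest entry sits alone in a new bottom row. It is disturbed only when a slide empties the
row above it, and then it moves up one row, so the row recorded is one too large. This happens at
the letters that `raise` changes. -/
theorem evac_cons_height {w : List ℕ} (h : IsYam w) :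
    evac (w.length + 1) (height w :: w) = raise (evac w.length w) ++ [0] := by
  induction hm : w.length generalizing w with
  | zero =>
    rw [List.length_eq_zero_iff] at hm
    subst hm
    simp [evac, raise, height, del]
  | succ m ih =>
    have hn : w ≠ [] := by rintro rfl; simp at hm
    have hl := length_del hn
    have hlm : (del w).2.length = m := by omega
    have hy := h.del hn
    have hlt := h.count_succ_lt hn
    have hcd := count_del hn
    have h0 : w.count (height w) = 0 :=
      List.count_eq_zero.2 fun hm => lt_irrefl _ (lt_height hm)
    have hev : ∀ i, i ∈ evac m (del w).2 ↔ i ∈ (del w).2 := by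
      rw [← hlm]
      exact mem_iff_of_count count_evac
    have hρ : (del w).1 < height w := lt_height (List.count_pos_iff.1 (by omega))
    have e1 : evac (m + 1) w = (del w).1 :: evac m (del w).2 := rfl
    have e2 : evac (m + 1 + 1) (height w :: w) =
      (del (height w :: w)).1 :: evac (m + 1) (del (height w :: w)).2 := rfl
    rw [e1, e2, del_cons _ hn, raise]
    -- Either the row that loses a box survives, or it was the bottom row with a single box and the
    -- hole passes down the first column.
    by_cases hd : (del w).1 ∈ (del w).2
    · rw [if_neg, if_pos ((hev _).2 hd)]
      · have : height (del w).2 = height w := by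
          refine height_congr fun i => ?_
          rw [← List.count_pos_iff, ← List.count_pos_iff, hcd i]
          split_ifs with hi
          · subst hi
            simp [List.count_pos_iff.2 hd]
          · simp
        rw [← this, ih hy hlm]
        rfl
      · rintro ⟨h1, h2⟩
        rw [← h1, h0] at h2
        have h3 := hcd (del w).1
        have h4 := List.count_pos_iff.2 hd
        rw [if_pos rfl] at h3
        omega
    · have hc : w.count (del w).1 = 1 := by
        have := hcd (del w).1
        rw [List.count_eq_zero.2 hd] at this
        simpa using this
      have hh : height w = (del w).1 + 1 := by
        refine le_antisymm (not_lt.1 fun hl => ?_) hρ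
        have := List.count_pos_iff.2 (h.isGrowth.mem hl)
        omega
      have hh' : height (del w).2 = (del w).1 := by
        refine le_antisymm (not_lt.1 fun hl => hd (hy.isGrowth.mem hl)) (not_lt.1 fun hl => ?_)
        have hm := h.isGrowth.mem (hl.trans hρ)
        rw [← List.count_pos_iff, hcd, if_neg hl.ne, add_zero, List.count_pos_iff] at hm
        exact lt_irrefl _ (lt_height hm)
      rw [if_pos ⟨hh, by omega⟩, if_neg fun h => hd ((hev _).1 h)]
      have := ih hy hlm
      rw [hh'] at this
      simp only [this]
      rfl

/-- The hole runs down the first column: each raised first box lies directly below it and returns to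
its original row; all other boxes stay. -/
theorem del_raise {w : List ℕ} (h : IsGrowth w) : del (raise w ++ [0]) = (height w, w) := by
  induction w with
  | nil => simp [raise, del, height]
  | cons x w ih =>
    have hne : raise w ++ [0] ≠ [] := by simp
    have hc := count_del hne
    have h0 : w.count (height w) = 0 :=
      List.count_eq_zero.2 fun hm => lt_irrefl _ (lt_height hm)
    have h1 : w.count (height w + 1) = 0 :=
      List.count_eq_zero.2 fun hm => by have := lt_height hm; omega
    rw [ih h.1] at hc
    rw [raise, List.cons_append, del_cons _ hne, ih h.1, height_cons]
    by_cases hx : x ∈ w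
    · have := lt_height hx
      rw [if_pos hx, if_neg (fun h => by simp at h; omega), max_eq_right (by omega)]
    · have := h.eq_height hx
      rw [if_neg hx, if_pos ⟨by simp [this], by simp [hc, h0, h1]⟩, max_eq_left (by omega), ← this]

theorem length_raise (w : List ℕ) : (raise w).length = w.length := by
  induction w with
  | nil => rfl
  | cons x w ih => simp [raise, ih]

theorem length_arch (w : List ℕ) : (arch w).length = w.length + 2 := by
  simp [arch, length_raise]

/-- `del_raise` undoes the raising and records the top letter of the new arch; `evac_cons_height`
then supplies the remaining letters. -/
theorem evac_arch {w : List ℕ} (h : IsYam w) :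
    evac (arch w).length (arch w) = arch (evac w.length w) := by
  have hh : height (evac w.length w) = height w := height_congr (mem_iff_of_count count_evac)
  have h0 : height w ∉ evac w.length w := fun hm => by
    have := lt_height hm
    omega
  rw [length_arch, evac, arch, del_raise h.cons_height.isGrowth, arch, hh, raise, if_neg h0,
    evac_cons_height h, height_cons, max_eq_left (by omega)]
  rfl

end RowWord

/-! ### Richardson words and their factorization into points and arches -/

namespace RowWord

theorem mem_of_find {x : ℕ} {w : List ℕ}
    (h : w.find? (fun y => decide (x ≤ y + 1)) = some (x - 1)) : x - 1 ∈ w :=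
  List.mem_of_find?_eq_some h

theorem IsRich.isGrowth {w : List ℕ} (h : IsRich w) : IsGrowth w := by
  induction w with
  | nil => trivial
  | cons x w ih =>
    refine ⟨ih h.1, ?_⟩
    rcases h.2 with rfl | h
    · simp
    · have := lt_height (mem_of_find h)
      omega

/-- The latest box in rows x - 1 and below was put into row x - 1, and since then row x has not
grown. This makes Richardson words lattice words. -/
theorem IsYam.count_lt_of_find {w : List ℕ} (hw : IsYam w) {x : ℕ} (hx : x ≠ 0)
    (h : w.find? (fun y => decide (x ≤ y + 1)) = some (x - 1)) :
    w.count x < w.count (x - 1) := by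
  induction w with
  | nil => simp at h
  | cons y w ih =>
    rw [List.find?_cons] at h
    split at h
    · next hy =>
      obtain rfl : y = x - 1 := by simpa using h
      have h2 := hw.1.count_le (x - 1)
      rw [show x - 1 + 1 = x by omega] at h2
      rw [List.count_cons_self, List.count_cons_of_ne (by omega)]
      omega
    · next hy =>
      have hy : ¬ x ≤ y + 1 := by simpa using hy
      rw [List.count_cons_of_ne (by omega), List.count_cons_of_ne (by omega)]
      exact ih hw.1 h

theorem isYam_cons {x : ℕ} {w : List ℕ} :
    IsYam (x :: w) ↔ IsYam w ∧ (x = 0 ∨ w.count x < w.count (x - 1)) := by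
  constructor
  · rintro ⟨h, h'⟩
    refine ⟨h, ?_⟩
    cases x with
    | zero => simp
    | succ x =>
      have := h' x
      simp at this
      simp
      omega
  · rintro ⟨h, h'⟩
    refine ⟨h, fun i => ?_⟩
    have h1 := h.count_le i
    simp only [List.count_cons, beq_iff_eq]
    by_cases hx : x = i + 1
    · subst hx
      simp at h' ⊢
      omega
    · simp [hx]
      omega

theorem IsRich.isYam {w : List ℕ} (h : IsRich w) : IsYam w := by
  induction w with
  | nil => trivial
  | cons x w ih =>
    refine isYam_cons.2 ⟨ih h.1, ?_⟩
    by_cases hx : x = 0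
    · exact .inl hx
    · exact .inr ((ih h.1).count_lt_of_find hx (h.2.resolve_left hx))

theorem IsRich.append {v w : List ℕ} (hv : IsRich v) (hw : IsRich w) : IsRich (v ++ w) := by
  induction v with
  | nil => exact hw
  | cons x v ih =>
    refine ⟨ih hv.1, hv.2.imp_right fun h => ?_⟩
    change (v ++ w).find? _ = _
    rw [List.find?_append, h]
    rfl

theorem IsRich.of_append {v w : List ℕ} (h : IsRich (v ++ w)) : IsRich w := by
  induction v with
  | nil => exact h
  | cons x v ih => exact ih h.1

theorem find_height {v w : List ℕ} (hw : IsGrowth w) (hn : 0 < height w) :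
    (w ++ v).find? (fun y => decide (height w ≤ y + 1)) = some (height w - 1) := by
  have hm := hw.mem (i := height w - 1) (by omega)
  have hl : ∀ y ∈ w, y < height w := fun y hy => lt_height hy
  -- The bound must stay fixed while the induction shortens the word.
  generalize height w = n at *
  induction w with
  | nil => simp at hm
  | cons x w ih =>
    rw [List.cons_append, List.find?_cons]
    have := hl x (by simp)
    split
    · next h =>
      have h : n ≤ x + 1 := by simpa using h
      congr 1
      omega
    · next h =>
      have h : ¬ n ≤ x + 1 := by simpa using h
      refine ih hw.1 ?_ fun y hy => hl y (by simp [hy])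
      rcases List.mem_cons.1 hm with hm | hm
      · omega
      · exact hm

theorem IsRich.cons_height {w : List ℕ} (h : IsRich w) : IsRich (height w :: w) := by
  refine ⟨h, ?_⟩
  by_cases h0 : height w = 0
  · exact .inl h0
  · have := find_height (v := []) h.isGrowth (by omega)
    rw [List.append_nil] at this
    exact .inr this

/-- Letters that are not raised behave alike in both searches. A letter x that opens a row stops
both, and since z ≤ x neither x nor x + 1 equals z - 1. -/
theorem find_raise {v w : List ℕ} (hw : IsGrowth w) {z : ℕ} (hz : z ≠ 0) (h : z < height w) :
    (raise w ++ v).find? (fun y => decide (z ≤ y + 1)) = some (z - 1) ↔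
      w.find? (fun y => decide (z ≤ y + 1)) = some (z - 1) := by
  induction w with
  | nil => simp [height] at h
  | cons x w ih =>
    rw [height_cons] at h
    rw [raise, List.cons_append]
    by_cases hx : x ∈ w
    · have := lt_height hx
      rw [if_pos hx, List.find?_cons, List.find?_cons]
      split
      · rfl
      · exact ih hw.1 (by omega)
    · have := hw.eq_height hx
      rw [if_neg hx, List.find?_cons_of_pos (by simp; omega),
        List.find?_cons_of_pos (by simp; omega)]
      simp
      omega

theorem height_raise_append {w : List ℕ} (hw : IsGrowth w) :
    height (raise w ++ [0]) = height w + 1 := by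
  induction w with
  | nil => simp [raise, height]
  | cons x w ih =>
    rw [raise, List.cons_append, height_cons, ih hw.1, height_cons]
    by_cases hx : x ∈ w
    · have := lt_height hx
      rw [if_pos hx]
      omega
    · have := hw.eq_height hx
      rw [if_neg hx]
      omega

theorem isRich_raise_append {w : List ℕ} (h : IsRich w) : IsRich (raise w ++ [0]) := by
  have hg := h.isGrowth
  induction w with
  | nil => simp [raise, IsRich]
  | cons x w ih =>
    have h1 := ih h.1 hg.1
    rw [raise, List.cons_append]
    by_cases hx : x ∈ w
    · rw [if_pos hx]
      refine ⟨h1, ?_⟩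
      by_cases h0 : x = 0
      · exact .inl h0
      · exact .inr ((find_raise hg.1 h0 (lt_height hx)).2 (h.2.resolve_left h0))
    · rw [if_neg hx, hg.eq_height hx, ← height_raise_append hg.1]
      exact h1.cons_height

theorem isRich_arch {w : List ℕ} (h : IsRich w) : IsRich (arch w) :=
  isRich_raise_append h.cons_height

/-- If the letter `r + 1` may be appended to a Richardson word, then the latter ends with an arch
whose last entry is missing. -/
theorem exists_raise_of_find {v : List ℕ} (hv : IsRich v) {r : ℕ}
    (h : v.find? (fun y => decide (r + 1 ≤ y + 1)) = some r) :
    ∃ w u, IsRich w ∧ height w = r ∧ v = raise w ++ 0 :: u := by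
  induction v generalizing r with
  | nil => simp at h
  | cons y v ih =>
    rw [List.find?_cons] at h
    split at h
    · obtain rfl : y = r := by simpa using h
      -- A letter 0 closes the arch. A positive letter opened its own row, so the arch below it is
      -- extended by a letter equal to the height, which `raise` turns into this one.
      cases y with
      | zero => exact ⟨[], v, trivial, rfl, rfl⟩
      | succ y =>
        obtain ⟨w, u, hw, hh, rfl⟩ := ih hv.1 (hv.2.resolve_left (by omega))
        refine ⟨y :: w, u, hh ▸ hw.cons_height, by rw [height_cons]; omega, ?_⟩
        rw [raise, if_neg]
        · rfl
        · intro hm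
          have := lt_height hm
          omega
    · next hy =>
      have hy : y < r := by simpa using hy
      obtain ⟨w, u, hw, hh, rfl⟩ := ih hv.1 h
      have hyw : y < height w := by omega
      have hm : y ∈ w := hw.isGrowth.mem hyw
      refine ⟨y :: w, u, ⟨hw, ?_⟩, by rw [height_cons]; omega, by rw [raise, if_pos hm]; rfl⟩
      by_cases h0 : y = 0
      · exact .inl h0
      · exact .inr ((find_raise hw.isGrowth h0 hyw).1 (hv.2.resolve_left h0))

theorem IsGrowth.of_append {v w : List ℕ} (h : IsGrowth (v ++ w)) : IsGrowth w := by
  induction v with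
  | nil => exact h
  | cons x v ih => exact ih h.1

/-- No end of an arch other than the whole arch is a word with restricted growth. -/
theorem not_isGrowth_of_prefix_raise {w : List ℕ} (hw : IsGrowth w) {s : List ℕ} (hs : s ≠ [])
    (hp : s <+: raise (height w :: w)) : ¬ IsGrowth s := by
  intro hg
  induction w generalizing s with
  | nil =>
    obtain ⟨t, ht⟩ := hp
    cases s with
    | nil => exact hs rfl
    | cons y s =>
      simp [raise, height] at ht
      obtain ⟨rfl, rfl, -⟩ := ht
      have := hg.2
      simp [height] at this
  | cons x w ih =>
    have hnm : height (x :: w) ∉ x :: w := fun hm => lt_irrefl _ (lt_height hm)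
    rw [raise, if_neg hnm] at hp
    cases s with
    | nil => exact hs rfl
    | cons y s =>
      rw [List.cons_prefix_cons] at hp
      obtain ⟨rfl, hp⟩ := hp
      rw [raise] at hp
      cases s with
      | nil =>
        have := hg.2
        simp [height] at this
      | cons z s =>
        rw [List.cons_prefix_cons] at hp
        obtain ⟨rfl, hp⟩ := hp
        -- If x opens no row, it is too small to support the head and can be dropped. If it opens a
        -- row, then x + 1 is the head of the shorter arch and the old head is dropped.
        by_cases hx : x ∈ w
        · have hlt := lt_height hx
          have hh : height (x :: w) = height w := by
            rw [height_cons]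
            omega
          rw [if_pos hx, hh] at hg
          have h2 := hg.2
          rw [height_cons] at h2
          have hnm : height w ∉ w := fun hm => lt_irrefl _ (lt_height hm)
          refine ih hw.1 (s := (height w + 1) :: s) (by simp) ?_ ⟨hg.1.1, by omega⟩
          rw [raise, if_neg hnm, List.cons_prefix_cons]
          exact ⟨rfl, hp⟩
        · have hh := hw.eq_height hx
          rw [if_neg hx] at hg
          refine ih hw.1 (s := (x + 1) :: s) (by simp) ?_ hg.1
          rw [raise, if_neg (hh ▸ hx), List.cons_prefix_cons]
          exact ⟨by rw [hh], hp⟩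

theorem raise_injective {v w : List ℕ} (hv : IsGrowth v) (hw : IsGrowth w)
    (h : raise v ++ [0] = raise w ++ [0]) : v = w := by
  have h1 := del_raise hv
  rw [h, del_raise hw] at h1
  exact (congrArg Prod.snd h1).symm

/-- A nonempty word with restricted growth begins with at most one arch. -/
theorem append_arch_injective {a b u v : List ℕ} (ha : IsGrowth a) (hb : IsGrowth b)
    (hu : IsGrowth u) (hv : IsGrowth v) (h : u ++ arch a = v ++ arch b) : u = v ∧ a = b := by
  have key : ∀ {a b u v : List ℕ}, IsGrowth b → IsGrowth u →
      u ++ arch a = v ++ arch b → u.length ≤ v.length := by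
    intro a b u v hb hu h
    -- Otherwise the part of `u` beyond `v` would have restricted growth and be a proper end of the
    -- arch over `b`.
    by_contra! hl
    obtain ⟨t, ht⟩ := List.prefix_of_prefix_length_le (List.prefix_append v (arch b))
      (h ▸ List.prefix_append u (arch a)) hl.le
    subst ht
    have htn : t ≠ [] := by
      rintro rfl
      simp at hl
    rw [List.append_assoc, List.append_cancel_left_eq] at h
    refine not_isGrowth_of_prefix_raise hb htn ?_ hu.of_append
    refine List.prefix_of_prefix_length_le (l₃ := arch b) ⟨_, h⟩ ⟨[0], rfl⟩ ?_
    have := congrArg List.length h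
    rw [List.length_append, length_arch, length_arch] at this
    rw [length_raise, List.length_cons]
    omega
  obtain ⟨rfl, h'⟩ := List.append_inj h (le_antisymm (key hb hu h) (key ha hv h.symm))
  refine ⟨rfl, ?_⟩
  have hc : ∀ {w : List ℕ}, IsGrowth w → IsGrowth (height w :: w) := fun h => ⟨h, le_rfl⟩
  exact (List.cons_eq_cons.1 (raise_injective (hc ha) (hc hb) h')).2

theorem append_arch_ne {a u v : List ℕ} (ha : IsGrowth a) (hv : IsGrowth v) :
    u ++ arch a ≠ v ++ [0] := by
  intro h
  obtain ⟨t, ht⟩ : u <+: v := by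
    refine List.prefix_of_prefix_length_le (l₃ := v ++ [0]) (h ▸ List.prefix_append _ _)
      (List.prefix_append _ _) ?_
    have := congrArg List.length h
    rw [List.length_append, length_arch] at this
    simp at this
    omega
  subst ht
  rw [List.append_assoc, List.append_cancel_left_eq, arch] at h
  have := List.append_inj_left' h rfl
  refine not_isGrowth_of_prefix_raise ha (s := t) ?_ (this ▸ List.prefix_refl _) hv.of_append
  rw [← this]
  simp [raise]

end RowWord

/-! ### Motzkin structures, their words and their paths -/

/-- Motzkin structures: sequences of points and of arches over Motzkin structures. -/
inductive MotzkinTree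
  | nil : MotzkinTree
  | flat : MotzkinTree → MotzkinTree
  | arch : MotzkinTree → MotzkinTree → MotzkinTree

namespace MotzkinTree

/-- Concatenation. -/
def app : MotzkinTree → MotzkinTree → MotzkinTree
  | nil, s => s
  | flat t, s => flat (app t s)
  | arch a t, s => arch a (app t s)

/-- Reversal. -/
def rev : MotzkinTree → MotzkinTree
  | nil => nil
  | flat t => app (rev t) (flat nil)
  | arch a t => app (rev t) (arch (rev a) nil)

/-- The associated Richardson word. -/
def word : MotzkinTree → List ℕ
  | nil => []
  | flat t => word t ++ [0]
  | arch a t => word t ++ RowWord.arch (word a)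

/-- The associated Motzkin path. -/
def path : MotzkinTree → List SignType
  | nil => []
  | flat t => .zero :: path t
  | arch a t => .pos :: (path a ++ .neg :: path t)

/-- The order turns around because words list the largest entry first. -/
theorem word_app (t s : MotzkinTree) : (t.app s).word = s.word ++ t.word := by
  induction t with
  | nil => simp [app, word]
  | flat t ih => simp [app, word, ih]
  | arch a t _ ih => simp [app, word, ih]

theorem path_app (t s : MotzkinTree) : (t.app s).path = t.path ++ s.path := by
  induction t with
  | nil => simp [app, path]
  | flat t ih => simp [app, path, ih]
  | arch a t _ ih => simp [app, path, ih]

theorem app_nil (t : MotzkinTree) : t.app nil = t := by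
  induction t with
  | nil => rfl
  | flat t ih => simp [app, ih]
  | arch a t _ ih => simp [app, ih]

open RowWord

theorem isRich_word (t : MotzkinTree) : IsRich t.word := by
  induction t with
  | nil => trivial
  | flat t ih => exact ih.append (by simp [IsRich])
  | arch a t ha ih => exact ih.append (isRich_arch ha)

theorem word_injective : Function.Injective word := by
  intro s t h
  induction s generalizing t with
  | nil =>
    cases t with
    | nil => rfl
    | flat t => simp [word] at h
    | arch a t => simp [word, RowWord.arch] at h
  | flat s ih =>
    cases t with
    | nil => simp [word] at h
    | flat t => rw [ih (List.append_inj_left' h rfl)]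
    | arch a t => exact absurd h.symm (append_arch_ne a.isRich_word.isGrowth s.isRich_word.isGrowth)
  | arch a s iha ih =>
    cases t with
    | nil => simp [word, RowWord.arch] at h
    | flat t => exact absurd h (append_arch_ne a.isRich_word.isGrowth t.isRich_word.isGrowth)
    | arch b t =>
      obtain ⟨h1, h2⟩ := append_arch_injective a.isRich_word.isGrowth b.isRich_word.isGrowth
        s.isRich_word.isGrowth t.isRich_word.isGrowth h
      rw [ih h1, iha h2]

/-- The head decides the last factor: a 0 is a point, and a letter r + 1 completes the arch found by
`exists_raise_of_find`. -/
theorem exists_word_eq {w : List ℕ} (hw : IsRich w) : ∃ t : MotzkinTree, t.word = w := by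
  induction hn : w.length using Nat.strong_induction_on generalizing w with
  | _ n ih =>
    cases w with
    | nil => exact ⟨nil, rfl⟩
    | cons x w =>
      rcases x with - | r
      · obtain ⟨t, ht⟩ := ih w.length (by simp [← hn]) hw.1 rfl
        exact ⟨t.app (flat nil), by simp [word_app, word, ht]⟩
      · obtain ⟨v, u, hv, rfl, rfl⟩ :=
          exists_raise_of_find hw.1 (hw.2.resolve_left (Nat.succ_ne_zero r))
        have hu : IsRich u := (IsRich.of_append (v := raise v ++ [0]) (by simpa using hw.1))
        obtain ⟨a, ha⟩ := ih v.length (by simp [← hn, length_raise]) hv rfl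
        obtain ⟨t, ht⟩ := ih u.length (by simp [← hn]; omega) hu rfl
        refine ⟨t.app (arch a nil), ?_⟩
        have : height v ∉ v := fun hm => lt_irrefl _ (lt_height hm)
        simp [word_app, word, ht, ha, RowWord.arch, raise, this]

theorem evac_word (t : MotzkinTree) : evac t.word.length t.word = t.rev.word := by
  induction t with
  | nil => rfl
  | flat t ih =>
    rw [word, evac_append (by simp [IsYam, List.count_cons]) t.isRich_word.isYam, ih, rev, word_app]
    rfl
  | arch a t iha ih =>
    rw [word, evac_append (isRich_arch a.isRich_word).isYam t.isRich_word.isYam, ih,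
      evac_arch a.isRich_word.isYam, iha, rev, word_app]
    rfl

theorem length_path (t : MotzkinTree) : t.path.length = t.word.length := by
  induction t with
  | nil => rfl
  | flat t ih => simp [path, word, ih]
  | arch a t iha ih =>
    simp [path, word, ih, iha, length_arch]
    omega

/-- Concatenation with the first member of a list of Motzkin structures. -/
def appHead (t : MotzkinTree) : List MotzkinTree → List MotzkinTree
  | [] => []
  | s :: l => t.app s :: l

/-- The Motzkin structures separated by the down steps leading to new minima of a path. -/
def parse : List SignType → List MotzkinTree
  | [] => [nil]
  | .zero :: p => appHead (flat nil) (parse p)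
  | .neg :: p => nil :: parse p
  | .pos :: p =>
    match parse p with
    | a :: t :: l => arch a t :: l
    | l => l

/-- Allowing an arbitrary continuation `p` makes the induction pass through arches; with `p` empty,
`parse` is a left inverse of `path`. -/
theorem parse_path_append (t : MotzkinTree) (p : List SignType) {l : List MotzkinTree}
    (h : parse p = l) (hl : l ≠ []) : parse (t.path ++ p) = appHead t l := by
  induction t generalizing p l with
  | nil =>
    cases l with
    | nil => exact absurd rfl hl
    | cons s l => exact h
  | flat t ih =>
    cases l with
    | nil => exact absurd rfl hl
    | cons s l => simp [path, parse, ih p h hl, appHead, app]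
  | arch a t iha ih =>
    cases l with
    | nil => exact absurd rfl hl
    | cons s l =>
      have h1 := ih p h hl
      have h2 := iha (.neg :: (t.path ++ p)) (l := nil :: t.app s :: l)
        (by rw [parse, h1]; rfl) (by simp)
      have e : (arch a t).path ++ p = .pos :: (a.path ++ .neg :: (t.path ++ p)) := by
        simp [path]
      rw [e, parse, h2]
      simp [appHead, app, app_nil]

theorem path_injective : Function.Injective path := by
  intro s t h
  have hs := parse_path_append s [] (l := [nil]) rfl (by simp)
  have ht := parse_path_append t [] (l := [nil]) rfl (by simp)
  rw [h, ht] at hs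
  simpa [appHead, app_nil] using hs.symm

end MotzkinTree

/-! ### Motzkin paths as lists of steps -/

/-- `IsMotzkinPath a b p`: the steps `p` lead from height `a` to height `b` and never go below the
axis. -/
def IsMotzkinPath : ℕ → ℕ → List SignType → Prop
  | a, b, [] => a = b
  | a, b, .zero :: p => IsMotzkinPath a b p
  | a, b, .pos :: p => IsMotzkinPath (a + 1) b p
  | a, b, .neg :: p => ∃ c, a = c + 1 ∧ IsMotzkinPath c b p

/-- Reversal of a path. -/
def reversePath (p : List SignType) : List SignType := (p.map fun s => -s).reverse

theorem isMotzkinPath_append {a c : ℕ} {p q : List SignType} :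
    IsMotzkinPath a c (p ++ q) ↔ ∃ b, IsMotzkinPath a b p ∧ IsMotzkinPath b c q := by
  induction p generalizing a with
  | nil => simp [IsMotzkinPath]
  | cons s p ih =>
    cases s
    · simp [IsMotzkinPath, ih]
    · simp only [List.cons_append, IsMotzkinPath, ih]
      grind
    · simp [IsMotzkinPath, ih]

theorem reversePath_append (p q : List SignType) :
    reversePath (p ++ q) = reversePath q ++ reversePath p := by
  simp [reversePath]

theorem reversePath_reversePath (p : List SignType) : reversePath (reversePath p) = p := by
  simp [reversePath]

theorem length_reversePath (p : List SignType) : (reversePath p).length = p.length := by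
  simp [reversePath]

theorem IsMotzkinPath.reverse {a b : ℕ} {p : List SignType} (h : IsMotzkinPath a b p) :
    IsMotzkinPath b a (reversePath p) := by
  induction p generalizing a with
  | nil => exact Eq.symm h
  | cons s p ih =>
    rw [← List.singleton_append, reversePath_append, isMotzkinPath_append]
    cases s
    · exact ⟨a, ih h, rfl⟩
    · obtain ⟨c, rfl, h⟩ := h
      exact ⟨c, ih h, rfl⟩
    · exact ⟨a + 1, ih h, a, rfl, rfl⟩

theorem IsMotzkinPath.succ {a b : ℕ} {p : List SignType} (h : IsMotzkinPath a b p) :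
    IsMotzkinPath (a + 1) (b + 1) p := by
  induction p generalizing a with
  | nil => exact congrArg (· + 1) h
  | cons s p ih =>
    cases s
    · exact ih (a := a) h
    · obtain ⟨c, rfl, h⟩ := h
      exact ⟨c + 1, rfl, ih h⟩
    · exact ih (a := a + 1) h

namespace MotzkinTree

theorem isMotzkinPath_path (t : MotzkinTree) : IsMotzkinPath 0 0 t.path := by
  induction t with
  | nil => rfl
  | flat t ih => exact ih
  | arch a t iha ih => exact isMotzkinPath_append.2 ⟨1, iha.succ, 0, rfl, ih⟩

/-- Cut at the first descent below the starting height. After an up step, this is applied to the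
inside of the arch and then again to what follows. -/
theorem exists_path_append {p : List SignType} {h : ℕ} (hp : IsMotzkinPath h 0 p) :
    ∃ t : MotzkinTree, (h = 0 ∧ p = t.path) ∨
      ∃ k q, h = k + 1 ∧ p = t.path ++ .neg :: q ∧ IsMotzkinPath k 0 q := by
  induction hn : p.length using Nat.strong_induction_on generalizing p h with
  | _ n ih =>
    cases p with
    | nil => exact ⟨nil, .inl ⟨hp, rfl⟩⟩
    | cons s p =>
      have hlt : p.length < n := by simp [← hn]
      cases s
      · obtain ⟨t, ⟨rfl, rfl⟩ | ⟨k, q, rfl, rfl, hq⟩⟩ := ih _ hlt (p := p) (h := h) hp rfl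
        · exact ⟨flat t, .inl ⟨rfl, rfl⟩⟩
        · exact ⟨flat t, .inr ⟨k, q, rfl, rfl, hq⟩⟩
      · obtain ⟨c, rfl, hp⟩ := hp
        exact ⟨nil, .inr ⟨c, p, rfl, rfl, hp⟩⟩
      · obtain ⟨a, ⟨h0, -⟩ | ⟨k, q, hk, rfl, hq⟩⟩ := ih _ hlt (p := p) (h := h + 1) hp rfl
        · omega
        · obtain rfl : k = h := by omega
          obtain ⟨t, ⟨rfl, rfl⟩ | ⟨k, r, rfl, rfl, hr⟩⟩ :=
            ih q.length (by simp at hlt; omega) hq rfl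
          · exact ⟨arch a t, .inl ⟨rfl, rfl⟩⟩
          · exact ⟨arch a t, .inr ⟨k, r, rfl, by simp [path], hr⟩⟩

theorem exists_path_eq {p : List SignType} (hp : IsMotzkinPath 0 0 p) :
    ∃ t : MotzkinTree, t.path = p := by
  obtain ⟨t, ⟨-, h⟩ | ⟨k, q, h, -⟩⟩ := exists_path_append hp
  · exact ⟨t, h.symm⟩
  · omega

theorem path_rev (t : MotzkinTree) : t.rev.path = reversePath t.path := by
  induction t with
  | nil => rfl
  | flat t ih => simp [rev, path_app, path, ih, reversePath]
  | arch a t iha ih => simp [rev, path_app, path, ih, iha, reversePath]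

end MotzkinTree

/-! ### Slides after adjoining a new largest entry -/

/-- The slide in the filling `f` makes `k` moves and stops at `e`. -/
structure IsSlide (f : ℕ × ℕ → ℕ) (k : ℕ) (e : ℕ × ℕ) : Prop where
  pos : slidePos f k = e
  move : ∀ j < k, slidePos f (j + 1) ≠ slidePos f j
  fixed : slideNext f e = e
  ne_zero : f (0, 0) ≠ 0

theorem slidePos_succ (f : ℕ × ℕ → ℕ) (k : ℕ) :
    slidePos f (k + 1) = slideNext f (slidePos f k) :=
  Function.iterate_succ_apply' _ _ _

theorem slideNext_ne_zero {f : ℕ × ℕ → ℕ} {c : ℕ × ℕ} (h : f c ≠ 0) : f (slideNext f c) ≠ 0 := by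
  unfold slideNext
  split_ifs <;> grind

theorem slidePos_ne_zero {f : ℕ × ℕ → ℕ} (h : f (0, 0) ≠ 0) (k : ℕ) : f (slidePos f k) ≠ 0 := by
  induction k with
  | zero => exact h
  | succ k ih =>
    rw [slidePos_succ]
    exact slideNext_ne_zero ih

theorem slideNext_eq_self {f : ℕ × ℕ → ℕ} {c : ℕ × ℕ} :
    slideNext f c = c ↔ f (c.1, c.2 + 1) = 0 ∧ f (c.1 + 1, c.2) = 0 := by
  obtain ⟨i, j⟩ := c
  unfold slideNext
  split_ifs <;> simp_all

section Update

variable {f : ℕ × ℕ → ℕ} {b : ℕ × ℕ} {m : ℕ}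

/-- The new maximum never wins against a neighbour already present, so the old slide path persists
until its end. -/
theorem slideNext_update_of_ne (hb : f b = 0) (hm : ∀ c, f c ≤ m) {c : ℕ × ℕ}
    (h : slideNext f c ≠ c) :
    slideNext (Function.update f b (m + 1)) c = slideNext f c := by
  rw [Ne, slideNext_eq_self] at h
  have h1 := hm (c.1, c.2 + 1)
  have h2 := hm (c.1 + 1, c.2)
  have h3 : (c.1, c.2 + 1) ≠ (c.1 + 1, c.2) := by simp
  unfold slideNext
  simp only [Function.update_apply]
  by_cases e1 : (c.1, c.2 + 1) = b
  · have e2 : (c.1 + 1, c.2) ≠ b := fun h => h3 (e1.trans h.symm)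
    rw [e1, hb] at h
    simp only [e1, if_true, if_neg e2, hb]
    simp at h
    simp [h]
    omega
  · by_cases e2 : (c.1 + 1, c.2) = b
    · rw [e2, hb] at h
      simp only [e2, if_true, if_neg e1, hb]
      simp at h
      simp [h]
      omega
    · simp only [if_neg e1, if_neg e2]

theorem slideNext_update_of_adj (hb : f b = 0) {c : ℕ × ℕ} (h : slideNext f c = c)
    (ha : b = (c.1, c.2 + 1) ∨ b = (c.1 + 1, c.2)) :
    slideNext (Function.update f b (m + 1)) c = b := by
  rw [slideNext_eq_self] at h
  unfold slideNext
  rcases ha with rfl | rfl <;> simp [h]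

theorem slideNext_update_of_not_adj {c : ℕ × ℕ} (h : slideNext f c = c)
    (ha : ¬(b = (c.1, c.2 + 1) ∨ b = (c.1 + 1, c.2))) :
    slideNext (Function.update f b (m + 1)) c = c := by
  rw [slideNext_eq_self] at h ⊢
  push Not at ha
  rw [Function.update_of_ne ha.1.symm, Function.update_of_ne ha.2.symm]
  exact h

theorem IsSlide.slidePos_update {k : ℕ} {e : ℕ × ℕ} (h : IsSlide f k e) (hb : f b = 0)
    (hm : ∀ c, f c ≤ m) {j : ℕ} (hj : j ≤ k) :
    slidePos (Function.update f b (m + 1)) j = slidePos f j := by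
  induction j with
  | zero => rfl
  | succ j ih =>
    have := h.move j hj
    rw [slidePos_succ] at this
    rw [slidePos_succ, ih (by omega), slidePos_succ, slideNext_update_of_ne hb hm this]

theorem IsSlide.update_of_adj {k : ℕ} {e : ℕ × ℕ} (h : IsSlide f k e) (hb : f b = 0)
    (hm : ∀ c, f c ≤ m) (ha : b = (e.1, e.2 + 1) ∨ b = (e.1 + 1, e.2))
    (hs : slideNext f b = b) : IsSlide (Function.update f b (m + 1)) (k + 1) b := by
  have hne : e ≠ b := by rcases ha with rfl | rfl <;> simp [Prod.ext_iff]
  have hk : slidePos (Function.update f b (m + 1)) (k + 1) = b := by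
    rw [slidePos_succ, h.slidePos_update hb hm le_rfl, h.pos,
      slideNext_update_of_adj hb h.fixed ha]
  refine ⟨hk, fun j hj => ?_, ?_, ?_⟩
  · rcases Nat.lt_succ_iff_lt_or_eq.1 hj with hj | rfl
    · rw [h.slidePos_update hb hm hj, h.slidePos_update hb hm hj.le]
      exact h.move j hj
    · rw [hk, h.slidePos_update hb hm le_rfl, h.pos]
      exact hne.symm
  · exact slideNext_update_of_not_adj hs (by simp [Prod.ext_iff])
  · rw [Function.update_of_ne]
    · exact h.ne_zero
    · rintro rfl
      exact h.ne_zero hb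

theorem IsSlide.update_of_not_adj {k : ℕ} {e : ℕ × ℕ} (h : IsSlide f k e) (hb : f b = 0)
    (hm : ∀ c, f c ≤ m) (ha : ¬(b = (e.1, e.2 + 1) ∨ b = (e.1 + 1, e.2))) :
    IsSlide (Function.update f b (m + 1)) k e := by
  refine ⟨?_, fun j hj => ?_, slideNext_update_of_not_adj h.fixed ha, ?_⟩
  · rw [h.slidePos_update hb hm le_rfl, h.pos]
  · rw [h.slidePos_update hb hm hj, h.slidePos_update hb hm hj.le]
    exact h.move j hj
  · rw [Function.update_of_ne]
    · exact h.ne_zero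
    · rintro rfl
      exact h.ne_zero hb

theorem IsSlide.slidePos_of_le {k : ℕ} {e : ℕ × ℕ} (h : IsSlide f k e) {j : ℕ} (hj : k ≤ j) :
    slidePos f j = e := by
  induction j, hj using Nat.le_induction with
  | base => exact h.pos
  | succ j _ ih => rw [slidePos_succ, ih, h.fixed]

open Classical in
theorem IsSlide.slideDelta_apply {k n : ℕ} {e : ℕ × ℕ} (h : IsSlide f k e) (hk : k < n)
    (c : ℕ × ℕ) : slideDelta n f c = if c = e then 0 else
      if ∃ j < k, slidePos f j = c then f (slideNext f c) - 1 else f c - 1 := by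
  unfold slideDelta slideEnd
  rw [h.slidePos_of_le hk.le]
  split_ifs with h1 h2 h3 h3
  · rfl
  · rfl
  · refine absurd ?_ h3
    obtain ⟨j, -, rfl⟩ := Finset.mem_image.1 h2
    exact ⟨j, not_le.1 fun hj => h1 (h.slidePos_of_le hj), rfl⟩
  · obtain ⟨j, hj, rfl⟩ := h3
    exact absurd (Finset.mem_image_of_mem _ (Finset.mem_range.2 (hj.trans hk))) h2
  · rfl

/-- The hole makes one more move, from `e` to `b`, and the new entry goes to `e`, lowered by one.
Otherwise it stays at `b`, which is `slideDelta_update_of_not_adj`. -/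
theorem IsSlide.slideDelta_update_of_adj {k n : ℕ} {e : ℕ × ℕ} (h : IsSlide f k e) (hk : k < n)
    (hb : f b = 0) (hm : ∀ c, f c ≤ m) (ha : b = (e.1, e.2 + 1) ∨ b = (e.1 + 1, e.2))
    (hs : slideNext f b = b) :
    slideDelta (n + 1) (Function.update f b (m + 1)) = Function.update (slideDelta n f) e m := by
  classical
  have hne : e ≠ b := by rcases ha with rfl | rfl <;> simp [Prod.ext_iff]
  have hp : ∀ j, slidePos f j ≠ b := fun j hj => slidePos_ne_zero h.ne_zero j (hj ▸ hb)
  funext c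
  rw [(h.update_of_adj hb hm ha hs).slideDelta_apply (by omega),
    Function.update_apply (slideDelta n f),
    h.slideDelta_apply hk]
  by_cases h1 : c = b
  · subst h1
    rw [if_pos rfl, if_neg hne.symm, if_neg hne.symm, if_neg (by simp [hp]), hb]
  · rw [if_neg h1]
    by_cases h2 : c = e
    · subst h2
      rw [if_pos rfl, if_pos, slideNext_update_of_adj hb h.fixed ha, Function.update_self]
      · rfl
      · exact ⟨k, by omega, by rw [h.slidePos_update hb hm le_rfl, h.pos]⟩
    · rw [if_neg h2, if_neg h2]
      by_cases h3 : ∃ j < k, slidePos f j = c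
      · obtain ⟨j, hj, rfl⟩ := h3
        have := h.move j hj
        rw [slidePos_succ] at this
        rw [if_pos ⟨j, by omega, h.slidePos_update hb hm hj.le⟩, if_pos ⟨j, hj, rfl⟩,
          slideNext_update_of_ne hb hm this, Function.update_of_ne]
        rw [← slidePos_succ]
        exact hp _
      · rw [if_neg h3, if_neg, Function.update_of_ne h1]
        rintro ⟨j, hj, rfl⟩
        rw [h.slidePos_update hb hm (by omega)] at h2 h3
        refine h3 ⟨j, lt_of_le_of_ne (by omega) ?_, rfl⟩
        rintro rfl
        exact h2 h.pos

theorem IsSlide.slideDelta_update_of_not_adj {k n : ℕ} {e : ℕ × ℕ} (h : IsSlide f k e)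
    (hk : k < n) (hb : f b = 0) (hm : ∀ c, f c ≤ m)
    (ha : ¬(b = (e.1, e.2 + 1) ∨ b = (e.1 + 1, e.2))) :
    slideDelta (n + 1) (Function.update f b (m + 1)) = Function.update (slideDelta n f) b m := by
  classical
  have hp : ∀ j, slidePos f j ≠ b := fun j hj => slidePos_ne_zero h.ne_zero j (hj ▸ hb)
  have hne : b ≠ e := fun hbe => hp k (h.pos.trans hbe.symm)
  have hex : ∀ c, (∃ j < k, slidePos (Function.update f b (m + 1)) j = c) ↔
      ∃ j < k, slidePos f j = c := fun c =>
    exists_congr fun j => and_congr_right fun hj => by rw [h.slidePos_update hb hm hj.le]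
  funext c
  rw [(h.update_of_not_adj hb hm ha).slideDelta_apply (by omega),
    Function.update_apply (slideDelta n f),
    h.slideDelta_apply hk]
  simp only [hex]
  by_cases h1 : c = b
  · subst h1
    rw [if_pos rfl, if_neg hne, if_neg (by simp [hp]), Function.update_self]
    rfl
  · rw [if_neg h1, Function.update_of_ne h1]
    split_ifs with h2 h3
    · rfl
    · obtain ⟨j, hj, rfl⟩ := h3
      have := h.move j hj
      rw [slidePos_succ] at this
      rw [slideNext_update_of_ne hb hm this, Function.update_of_ne]
      rw [← slidePos_succ]
      exact hp _
    · rfl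

end Update

/-! ### Fillings encoded by words -/

namespace RowWord

/-- The filling of the plane encoded by a word. -/
def fill : List ℕ → ℕ × ℕ → ℕ
  | [] => fun _ => 0
  | x :: w => Function.update (fill w) (x, w.count x) (w.length + 1)

theorem fill_le (w : List ℕ) (c : ℕ × ℕ) : fill w c ≤ w.length := by
  induction w with
  | nil => simp [fill]
  | cons x w ih =>
    rw [fill, Function.update_apply]
    split_ifs
    · simp
    · simpa using ih.trans (Nat.le_succ _)

theorem fill_ne_zero {w : List ℕ} {c : ℕ × ℕ} : fill w c ≠ 0 ↔ c.2 < w.count c.1 := by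
  induction w with
  | nil => simp [fill]
  | cons x w ih =>
    obtain ⟨i, j⟩ := c
    rw [fill, Function.update_apply, List.count_cons]
    split_ifs with h1 h2 h2 <;> simp_all
    omega

theorem fill_eq_zero {w : List ℕ} {c : ℕ × ℕ} : fill w c = 0 ↔ w.count c.1 ≤ c.2 := by
  rw [← not_lt, ← fill_ne_zero, not_not]

/-- This identifies `del` with the slide, by adjoining the largest entry to a smaller tableau. -/
theorem isSlide_fill {w : List ℕ} (hw : IsYam w) (hn : w ≠ []) :
    (∃ k < w.length, IsSlide (fill w) k ((del w).1, (del w).2.count (del w).1) ∧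
      slideDelta w.length (fill w) = fill (del w).2) := by
  induction w with
  | nil => exact absurd rfl hn
  | cons x w ih =>
    have h0 := (isYam_cons.1 hw).2
    by_cases hn' : w = []
    · subst hn'
      obtain rfl : x = 0 := by simpa using h0
      have hs : IsSlide (fill [0]) 0 (0, 0) :=
        ⟨rfl, by simp, by simp [slideNext_eq_self, fill_eq_zero], by simp [fill_eq_zero]⟩
      refine ⟨0, by simp, hs, ?_⟩
      classical
      funext c
      rw [hs.slideDelta_apply (by simp)]
      simp only [not_lt_zero, false_and, exists_false, if_false]
      split_ifs with hc
      · rfl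
      · simp [fill, del, hc]
    · obtain ⟨k, hk, hs, hd⟩ := ih hw.1 hn'
      have hb : fill w (x, w.count x) = 0 := fill_eq_zero.2 le_rfl
      have hst : slideNext (fill w) (x, w.count x) = (x, w.count x) := by
        have := hw.1.count_le x
        simp [slideNext_eq_self, fill_eq_zero, this]
      have hc := count_del hn'
      have hl := length_del hn'
      have hρ := hc (del w).1
      have hρ' := hc ((del w).1 + 1)
      rw [if_pos rfl] at hρ
      rw [if_neg (by simp), add_zero] at hρ'
      rw [del_cons x hn']
      by_cases ha : (x, w.count x) = ((del w).1, (del w).2.count (del w).1 + 1) ∨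
        (x, w.count x) = ((del w).1 + 1, (del w).2.count (del w).1)
      · refine ⟨k + 1, by simp [hk], ?_⟩
        have h1 := hs.update_of_adj hb (fill_le w) ha hst
        have h2 := hs.slideDelta_update_of_adj hk hb (fill_le w) ha hst
        rw [hd] at h2
        rw [List.length_cons, fill, h2]
        -- The new box is below the corner in the first case and to its right in the second.
        split_ifs with hx
        · obtain ⟨hx, hx'⟩ := hx
          refine ⟨?_, ?_⟩
          · convert h1 using 1
            simp [hx, hρ']
          · simp [fill, hl]
        · have hx' : x = (del w).1 := by
            rcases ha with ha | ha
            · exact (Prod.ext_iff.1 ha).1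
            · obtain ⟨h3, h4⟩ := Prod.ext_iff.1 ha
              simp only at h3 h4
              subst h3
              exact absurd ⟨rfl, by omega⟩ hx
          refine ⟨?_, ?_⟩
          · convert h1 using 1
            simp [hx', hρ]
          · simp [fill, hx', hl]
      · refine ⟨k, by simp; omega, ?_⟩
        have h1 := hs.update_of_not_adj hb (fill_le w) ha
        have h2 := hs.slideDelta_update_of_not_adj hk hb (fill_le w) ha
        rw [hd] at h2
        rw [not_or] at ha
        have hx : x ≠ (del w).1 := by
          rintro hx
          exact ha.1 (by rw [hx, hρ])
        rw [List.length_cons, fill, h2, if_neg]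
        · have := hc x
          rw [if_neg hx, add_zero] at this
          refine ⟨?_, ?_⟩
          · convert h1 using 1
            simp [List.count_cons_of_ne hx]
          · simp [fill, this, hl]
        · rintro ⟨rfl, h⟩
          exact ha.2 (by rw [Prod.mk.injEq]; exact ⟨rfl, by omega⟩)

theorem evacFilling_fill {w : List ℕ} (hw : IsYam w) :
    evacFilling w.length (fill w) = fill (evac w.length w) := by
  induction h : w.length generalizing w with
  | zero => rfl
  | succ m ih =>
    have hn : w ≠ [] := by rintro rfl; simp at h
    obtain ⟨k, hk, hs, hd⟩ := isSlide_fill hw hn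
    have hl := length_del hn
    have he : slideEnd (m + 1) (fill w) = _ := hs.slidePos_of_le (j := m + 1) (by omega)
    rw [h] at hd
    have hlm : (del w).2.length = m := by omega
    have hle : (evac m (del w).2).length = m := by
      clear * -
      generalize (del w).2 = v
      induction m generalizing v with
      | zero => rfl
      | succ m ih => simp [evac, ih]
    have hce : (evac m (del w).2).count (del w).1 = (del w).2.count (del w).1 := by
      rw [← hlm, count_evac]
    funext c
    rw [evacFilling, he, hd, ih (hw.del hn) hlm, evac, fill, Function.update_apply, hce, hle]

/-- The position of the largest entry gives the head; erasing it gives the filling of the tail. -/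
theorem fill_injective {v w : List ℕ} (hl : v.length = w.length) (h : fill v = fill w) :
    v = w := by
  induction v generalizing w with
  | nil => exact (List.length_eq_zero_iff.1 hl.symm).symm
  | cons x v ih =>
    cases w with
    | nil => simp at hl
    | cons y w =>
      have hl : v.length = w.length := by simpa using hl
      have hb : (x, v.count x) = (y, w.count y) := by
        by_contra hne
        have h1 := congrFun h (x, v.count x)
        rw [fill, fill, Function.update_self, Function.update_of_ne hne] at h1
        have := fill_le w (x, v.count x)
        omega
      have h2 : fill v = fill w := by
        have e1 : Function.update (fill (x :: v)) (x, v.count x) 0 = fill v := by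
          rw [fill, Function.update_idem, Function.update_eq_self_iff, eq_comm, fill_eq_zero]
        have e2 : Function.update (fill (y :: w)) (y, w.count y) 0 = fill w := by
          rw [fill, Function.update_idem, Function.update_eq_self_iff, eq_comm, fill_eq_zero]
        rw [← e1, ← e2, h, hb]
      rw [ih hl h2, show x = y from (Prod.ext_iff.1 hb).1]

end RowWord

/-! ### Standard tableaux, standard fillings and lattice words -/

/-- The fillings of the plane that come from standard tableaux with `m` boxes. -/
structure IsStandardFilling (m : ℕ) (f : ℕ × ℕ → ℕ) : Prop where
  le : ∀ c, f c ≤ m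
  surj : ∀ j, 1 ≤ j → j ≤ m → ∃ c, f c = j
  inj : ∀ c d, f c = f d → f c ≠ 0 → c = d
  row : ∀ i j, f (i, j + 1) ≠ 0 → f (i, j) ≠ 0 ∧ f (i, j) < f (i, j + 1)
  col : ∀ i j, f (i + 1, j) ≠ 0 → f (i, j) ≠ 0 ∧ f (i, j) < f (i + 1, j)

namespace StandardTableau

variable {n : ℕ}

theorem filling_mem_Icc (T : StandardTableau n) {c : ℕ × ℕ} (h : c ∈ T.shape) :
    T.filling c ∈ Finset.Icc 1 n := by
  rw [← T.entries]
  exact Finset.mem_image_of_mem (fun c : ℕ × ℕ => T.tab c.1 c.2) h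

theorem filling_ne_zero (T : StandardTableau n) {c : ℕ × ℕ} : T.filling c ≠ 0 ↔ c ∈ T.shape := by
  constructor
  · intro h
    by_contra hc
    exact h (T.tab.zeros hc)
  · intro h
    have := Finset.mem_Icc.1 (T.filling_mem_Icc h)
    omega

theorem isStandardFilling (T : StandardTableau n) : IsStandardFilling n T.filling := by
  have hinj : Set.InjOn T.filling T.shape.cells := by
    rw [← Finset.card_image_iff]
    change (T.shape.cells.image (fun c => T.tab c.1 c.2)).card = _
    rw [T.entries, Nat.card_Icc, Nat.add_sub_cancel]
    exact T.card_shape.symm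
  have hinj' : ∀ c d, T.filling c = T.filling d → T.filling c ≠ 0 → c = d := fun c d h h0 =>
    hinj (T.filling_ne_zero.1 h0) (T.filling_ne_zero.1 (h ▸ h0)) h
  refine ⟨fun c => ?_, fun j h1 h2 => ?_, hinj', fun i j h => ?_, fun i j h => ?_⟩
  · by_cases hc : c ∈ T.shape
    · exact (Finset.mem_Icc.1 (T.filling_mem_Icc hc)).2
    · rw [← T.filling_ne_zero, not_not] at hc
      omega
  · have : j ∈ T.shape.cells.image (fun c => T.tab c.1 c.2) := by
      rw [T.entries]
      exact Finset.mem_Icc.2 ⟨h1, h2⟩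
    obtain ⟨c, -, hc⟩ := Finset.mem_image.1 this
    exact ⟨c, hc⟩
  · have hm := T.filling_ne_zero.1 h
    have hm' : (i, j) ∈ T.shape := T.shape.up_left_mem le_rfl (Nat.le_succ j) hm
    refine ⟨T.filling_ne_zero.2 hm', lt_of_le_of_ne (T.tab.row_weak (Nat.lt_succ_self j) hm) ?_⟩
    intro he
    simpa using hinj' _ _ he (T.filling_ne_zero.2 hm')
  · have hm := T.filling_ne_zero.1 h
    have hm' : (i, j) ∈ T.shape := T.shape.up_left_mem (Nat.le_succ i) le_rfl hm
    exact ⟨T.filling_ne_zero.2 hm', T.tab.col_strict (Nat.lt_succ_self i) hm⟩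

theorem filling_injective : Function.Injective (filling (n := n)) := by
  intro S T h
  have hs : S.shape = T.shape := by
    ext c
    rw [YoungDiagram.mem_cells, YoungDiagram.mem_cells, ← S.filling_ne_zero, h, T.filling_ne_zero]
  obtain ⟨μ, h1, t, h2⟩ := S
  obtain ⟨ν, h3, u, h4⟩ := T
  obtain rfl : μ = ν := hs
  have : t = u := by
    ext i j
    exact congrFun h (i, j)
  subst this
  rfl

end StandardTableau

theorem IsStandardFilling.row_le {m : ℕ} {f : ℕ × ℕ → ℕ} (h : IsStandardFilling m f) {i j k : ℕ}
    (hjk : j ≤ k) (h0 : f (i, k) ≠ 0) : f (i, j) ≠ 0 ∧ f (i, j) ≤ f (i, k) := by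
  induction k, hjk using Nat.le_induction with
  | base => exact ⟨h0, le_rfl⟩
  | succ k _ ih =>
    obtain ⟨h1, h2⟩ := h.row i k h0
    exact ⟨(ih h1).1, (ih h1).2.trans h2.le⟩

theorem IsStandardFilling.col_le {m : ℕ} {f : ℕ × ℕ → ℕ} (h : IsStandardFilling m f) {i j k : ℕ}
    (hik : i ≤ k) (h0 : f (k, j) ≠ 0) : f (i, j) ≠ 0 ∧ f (i, j) ≤ f (k, j) := by
  induction k, hik using Nat.le_induction with
  | base => exact ⟨h0, le_rfl⟩
  | succ k _ ih =>
    obtain ⟨h1, h2⟩ := h.col k j h0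
    exact ⟨(ih h1).1, (ih h1).2.trans h2.le⟩

/-- The shape is the support of `f`, obtained as the image of a choice of position for each entry.
-/
theorem IsStandardFilling.exists_filling_eq {m : ℕ} {f : ℕ × ℕ → ℕ} (h : IsStandardFilling m f) :
    ∃ T : StandardTableau m, T.filling = f := by
  have : ∀ j, ∃ c, 1 ≤ j → j ≤ m → f c = j := by
    intro j
    by_cases hj : 1 ≤ j ∧ j ≤ m
    · obtain ⟨c, hc⟩ := h.surj j hj.1 hj.2
      exact ⟨c, fun _ _ => hc⟩
    · exact ⟨(0, 0), fun h1 h2 => absurd ⟨h1, h2⟩ hj⟩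
  choose g hg using this
  have hmem : ∀ c, c ∈ (Finset.Icc 1 m).image g ↔ f c ≠ 0 := by
    intro c
    simp only [Finset.mem_image, Finset.mem_Icc]
    constructor
    · rintro ⟨j, ⟨h1, h2⟩, rfl⟩
      rw [hg j h1 h2]
      omega
    · intro h0
      have h1 : 1 ≤ f c := Nat.one_le_iff_ne_zero.2 h0
      refine ⟨f c, ⟨h1, h.le c⟩, (h.inj _ _ (hg _ h1 (h.le c)).symm h0).symm⟩
  let μ : YoungDiagram :=
    { cells := (Finset.Icc 1 m).image g
      isLowerSet := by
        rintro ⟨i, j⟩ ⟨k, l⟩ hle hc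
        rw [Finset.mem_coe, hmem] at hc ⊢
        exact (h.row_le hle.2 (h.col_le hle.1 hc).1).1 }
  have hμ : ∀ c, c ∈ μ ↔ f c ≠ 0 := hmem
  let t : SemistandardYoungTableau μ :=
    { entry := fun i j => f (i, j)
      row_weak' := fun {i j k} hjk hc => (h.row_le hjk.le ((hμ _).1 hc)).2
      col_strict' := fun {i k j} hik hc => by
        obtain ⟨k, rfl⟩ : ∃ k', k = k' + 1 := ⟨k - 1, by omega⟩
        obtain ⟨h1, h2⟩ := h.col k j ((hμ _).1 hc)
        exact (h.col_le (Nat.lt_succ_iff.1 hik) h1).2.trans_lt h2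
      zeros' := fun {i j} hc => by
        rw [hμ, not_not] at hc
        exact hc }
  refine ⟨⟨μ, ?_, t, ?_⟩, rfl⟩
  · change ((Finset.Icc 1 m).image g).card = m
    rw [Finset.card_image_of_injOn, Nat.card_Icc, Nat.add_sub_cancel]
    intro i hi j hj hij
    have hi := Finset.mem_Icc.1 hi
    have hj := Finset.mem_Icc.1 hj
    rw [← hg i hi.1 hi.2, hij, hg j hj.1 hj.2]
  · change ((Finset.Icc 1 m).image g).image f = _
    rw [Finset.image_image]
    conv_rhs => rw [← Finset.image_id (s := Finset.Icc 1 m)]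
    refine Finset.image_congr fun i hi => ?_
    have hi := Finset.mem_Icc.1 hi
    exact hg i hi.1 hi.2

namespace RowWord

theorem isStandardFilling_fill {w : List ℕ} (hw : IsYam w) :
    IsStandardFilling w.length (fill w) := by
  induction w with
  | nil => exact ⟨by simp [fill], by intro j h1 h2; simp at h2; omega, by simp [fill], by simp [fill],
      by simp [fill]⟩
  | cons x w ih =>
    have ih := ih hw.1
    have hle := hw.count_le
    have hb : ∀ c, fill w c ≠ w.length + 1 := fun c => by have := ih.le c; omega
    refine ⟨fill_le _, fun j h1 h2 => ?_, fun c d h h0 => ?_, fun i j h => ?_, fun i j h => ?_⟩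
    · rcases Nat.le_succ_iff.1 h2 with h2 | h2
      · obtain ⟨c, hc⟩ := ih.surj j h1 h2
        refine ⟨c, ?_⟩
        rw [fill, Function.update_of_ne, hc]
        rintro rfl
        rw [fill_eq_zero.2 le_rfl] at hc
        omega
      · exact ⟨(x, w.count x), by rw [fill, Function.update_self, h2]⟩
    · rw [fill, Function.update_apply, Function.update_apply] at h
      rw [fill, Function.update_apply] at h0
      split_ifs at h h0 with h1 h2 h2
      · rw [h1, h2]
      · exact absurd h.symm (hb d)
      · exact absurd h (hb c)
      · exact ih.inj c d h h0
    · have h1 : fill (x :: w) (i, j) ≠ 0 := by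
        rw [fill_ne_zero] at h ⊢
        exact (Nat.lt_succ_self j).trans h
      refine ⟨h1, ?_⟩
      rw [fill, Function.update_apply] at h h1
      rw [fill, Function.update_apply, Function.update_apply]
      split_ifs at h h1 ⊢ with h2 h3 h3
      · simp [Prod.ext_iff] at h2 h3
        omega
      · obtain ⟨rfl, h2⟩ := Prod.mk.injEq .. ▸ h2
        have := fill_ne_zero.1 h
        simp only at this
        omega
      · exact Nat.lt_succ_of_le (ih.le _)
      · exact (ih.row i j h).2
    · have h1 : fill (x :: w) (i, j) ≠ 0 := by
        rw [fill_ne_zero] at h ⊢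
        exact h.trans_le (hle i)
      refine ⟨h1, ?_⟩
      rw [fill, Function.update_apply] at h h1
      rw [fill, Function.update_apply, Function.update_apply]
      split_ifs at h h1 ⊢ with h2 h3 h3
      · simp [Prod.ext_iff] at h2 h3
        omega
      · obtain ⟨rfl, h2⟩ := Prod.mk.injEq .. ▸ h2
        have := hw.1.count_le i
        have := fill_ne_zero.1 h
        simp only at this
        omega
      · exact Nat.lt_succ_of_le (ih.le _)
      · exact (ih.col i j h).2

theorem exists_fill_eq {m : ℕ} {f : ℕ × ℕ → ℕ} (h : IsStandardFilling m f) :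
    ∃ w, IsYam w ∧ w.length = m ∧ fill w = f := by
  induction m generalizing f with
  | zero => exact ⟨[], trivial, rfl, funext fun c => (Nat.le_zero.1 (h.le c)).symm⟩
  | succ m ih =>
    obtain ⟨⟨x, y⟩, hc⟩ := h.surj (m + 1) (by omega) le_rfl
    have hlt : ∀ d, d ≠ (x, y) → f d ≤ m := fun d hd => by
      by_contra hlt
      have := h.le d
      exact hd (h.inj d _ (by omega) (by omega))
    have hg : IsStandardFilling m (Function.update f (x, y) 0) := by
      refine ⟨fun d => ?_, fun j h1 h2 => ?_, fun d e hde h0 => ?_, fun i j h0 => ?_,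
        fun i j h0 => ?_⟩
      · rw [Function.update_apply]
        split_ifs with hd
        · exact Nat.zero_le _
        · exact hlt d hd
      · obtain ⟨d, hd⟩ := h.surj j h1 (by omega)
        refine ⟨d, ?_⟩
        rw [Function.update_of_ne, hd]
        rintro rfl
        omega
      · have h1 : d ≠ (x, y) := by
          rintro rfl
          simp at h0
        rw [Function.update_of_ne h1] at hde h0
        have h2 : e ≠ (x, y) := by
          rintro rfl
          exact h0 (by simpa using hde)
        rw [Function.update_of_ne h2] at hde
        exact h.inj d e hde h0
      · have h1 : (i, j + 1) ≠ (x, y) := by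
          intro h1
          simp [h1] at h0
        rw [Function.update_of_ne h1] at h0
        obtain ⟨h2, h3⟩ := h.row i j h0
        have := hlt _ h1
        rw [Function.update_of_ne h1, Function.update_of_ne]
        · exact ⟨h2, h3⟩
        · intro he
          rw [he] at h3
          omega
      · have h1 : (i + 1, j) ≠ (x, y) := by
          intro h1
          simp [h1] at h0
        rw [Function.update_of_ne h1] at h0
        obtain ⟨h2, h3⟩ := h.col i j h0
        have := hlt _ h1
        rw [Function.update_of_ne h1, Function.update_of_ne]
        · exact ⟨h2, h3⟩
        · intro he
          rw [he] at h3
          omega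
    obtain ⟨w, hw, hl, hf⟩ := ih hg
    have hcount : w.count x = y := by
      refine le_antisymm (fill_eq_zero.1 (by rw [hf, Function.update_self])) ?_
      cases y with
      | zero => exact Nat.zero_le _
      | succ y =>
        have h1 := (h.row x y (by omega)).1
        refine (fill_ne_zero (c := (x, y))).1 ?_
        rwa [hf, Function.update_of_ne (by simp)]
    refine ⟨x :: w, isYam_cons.2 ⟨hw, ?_⟩, by simp [hl], ?_⟩
    · cases x with
      | zero => exact .inl rfl
      | succ x =>
        right
        have h1 := (h.col x y (by omega)).1
        rw [hcount]
        refine (fill_ne_zero (c := (x, y))).1 ?_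
        rwa [hf, Function.update_of_ne (by simp)]
    · rw [fill, hcount, hf, Function.update_idem, hl, ← hc, Function.update_eq_self]

end RowWord

/-! ### The Richardson condition on fillings and on words -/

/-- The Richardson condition for a filling of the plane. -/
def IsRichardsonFilling (f : ℕ × ℕ → ℕ) : Prop :=
  ∀ c, f c ≠ 0 → 1 ≤ c.1 → ∀ d, f d ≠ 0 → c.1 ≤ d.1 → f d < f c →
    ∃ e : ℕ × ℕ, e.1 = c.1 - 1 ∧ f d < f e ∧ f e < f c

theorem StandardTableau.isRichardson_iff {n : ℕ} (T : StandardTableau n) :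
    T.IsRichardson ↔ IsRichardsonFilling T.filling := by
  unfold IsRichardson IsRichardsonFilling
  simp only [Finset.lt_sup_iff, rowBelow, Finset.mem_filter, YoungDiagram.mem_row_iff,
    ← T.filling_ne_zero]
  refine forall_congr' fun c => forall_congr' fun _ => forall_congr' fun _ => forall_congr' fun d =>
    forall_congr' fun _ => forall_congr' fun _ => forall_congr' fun _ => exists_congr fun e => ?_
  constructor
  · rintro ⟨⟨⟨-, h1⟩, h2⟩, h3⟩
    exact ⟨h1, h3, h2⟩
  · rintro ⟨h1, h3, h2⟩
    exact ⟨⟨⟨by omega, h1⟩, h2⟩, h3⟩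

namespace RowWord

/-- Both sides say that the largest entry in rows x - 1 and below lies in row x - 1. Without `hm`
the left side could hold vacuously while the search finds nothing. -/
theorem forall_exists_iff_find {x : ℕ} (hx : x ≠ 0) {w : List ℕ} (hm : x - 1 ∈ w) :
    (∀ d, fill w d ≠ 0 → x ≤ d.1 → ∃ e : ℕ × ℕ, e.1 = x - 1 ∧ fill w d < fill w e) ↔
      w.find? (fun y => decide (x ≤ y + 1)) = some (x - 1) := by
  induction w with
  | nil => simp at hm
  | cons y w ih =>
    rw [List.find?_cons]
    split
    · next hy =>
      have hy : x ≤ y + 1 := by simpa using hy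
      rw [Option.some_inj]
      constructor
      · intro h
        by_contra hne
        obtain ⟨e, -, h2⟩ := h (y, w.count y) (by simp [fill]) (by simp only; omega)
        have := fill_le (y :: w) e
        rw [fill, Function.update_self] at h2
        rw [fill, List.length_cons] at this
        omega
      · rintro rfl d - hd
        refine ⟨(x - 1, w.count (x - 1)), rfl, ?_⟩
        rw [fill, Function.update_self, Function.update_of_ne]
        · exact Nat.lt_succ_of_le (fill_le _ _)
        · rintro rfl
          simp only at hd
          omega
    · next hy =>
      have hy : ¬ x ≤ y + 1 := by simpa using hy
      have hm : x - 1 ∈ w := by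
        rcases List.mem_cons.1 hm with h | h
        · omega
        · exact h
      rw [← ih hm]
      have hne : ∀ d : ℕ × ℕ, x - 1 ≤ d.1 → fill (y :: w) d = fill w d := by
        intro d hd
        rw [fill, Function.update_of_ne]
        rintro rfl
        simp only at hd
        omega
      constructor
      · intro h d h1 h2
        obtain ⟨e, he, h3⟩ := h d (by rwa [hne d (by omega)]) h2
        rw [hne d (by omega), hne e he.ge] at h3
        exact ⟨e, he, h3⟩
      · intro h d h1 h2
        rw [hne d (by omega)] at h1
        obtain ⟨e, he, h3⟩ := h d h1 h2
        refine ⟨e, he, ?_⟩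
        rwa [hne d (by omega), hne e he.ge]

/-- The new largest entry affects no condition at an older box, and at the new box the upper bound
on the witness is automatic. -/
theorem isRichardsonFilling_cons {x : ℕ} {w : List ℕ} :
    IsRichardsonFilling (fill (x :: w)) ↔ IsRichardsonFilling (fill w) ∧
      (x = 0 ∨ ∀ d, fill w d ≠ 0 → x ≤ d.1 → ∃ e : ℕ × ℕ, e.1 = x - 1 ∧ fill w d < fill w e) := by
  have hb : fill w (x, w.count x) = 0 := fill_eq_zero.2 le_rfl
  have hs : fill (x :: w) (x, w.count x) = w.length + 1 := by rw [fill, Function.update_self]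
  have hne : ∀ c, c ≠ (x, w.count x) → fill (x :: w) c = fill w c := fun c hc => by
    rw [fill, Function.update_of_ne hc]
  have hle := fill_le w
  have hne' : ∀ c, fill w c ≠ 0 → fill (x :: w) c = fill w c := fun c hc => hne c <| by
    rintro rfl
    exact hc hb
  constructor
  · intro h
    refine ⟨fun c h1 h2 d h3 h4 h5 => ?_, ?_⟩
    · obtain ⟨e, he, h6, h7⟩ := h c (by rwa [hne' c h1]) h2 d (by rwa [hne' d h3]) h4
        (by rwa [hne' c h1, hne' d h3])
      have he' : e ≠ (x, w.count x) := by
        rintro rfl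
        rw [hs, hne' c h1] at h7
        have := hle c
        omega
      rw [hne e he', hne' _ h3] at h6
      rw [hne e he', hne' _ h1] at h7
      exact ⟨e, he, h6, h7⟩
    · by_cases hx : x = 0
      · exact .inl hx
      refine .inr fun d h1 h2 => ?_
      obtain ⟨e, he, h3, h4⟩ := h (x, w.count x) (by rw [hs]; omega) (by simp only; omega) d
        (by rwa [hne' d h1]) h2 (by rw [hs, hne' d h1]; have := hle d; omega)
      have he' : e ≠ (x, w.count x) := by
        rintro rfl
        simp only at he
        omega
      rw [hne e he', hne' _ h1] at h3
      exact ⟨e, he, h3⟩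
  · rintro ⟨h, h'⟩ c h1 h2 d h3 h4 h5
    by_cases hc : c = (x, w.count x)
    · subst hc
      have hd : d ≠ (x, w.count x) := by
        rintro rfl
        exact lt_irrefl _ h5
      rw [hne d hd] at h3 h5
      obtain ⟨e, he, h6⟩ := (h'.resolve_left (by simp only at h2; omega)) d h3 h4
      rw [hs, hne d hd]
      have := hle e
      exact ⟨e, he, by rwa [hne' e (by omega)], by rw [hne' e (by omega)]; omega⟩
    · rw [hne c hc] at h1 h5 ⊢
      have hd : d ≠ (x, w.count x) := by
        rintro rfl
        rw [hs] at h5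
        have := hle c
        omega
      rw [hne d hd] at h3 h5 ⊢
      obtain ⟨e, he, h6, h7⟩ := h c h1 h2 d h3 h4 h5
      exact ⟨e, he, by rwa [hne' e (by omega)], by rwa [hne' e (by omega)]⟩

theorem isRichardsonFilling_fill {w : List ℕ} (hw : IsYam w) :
    IsRichardsonFilling (fill w) ↔ IsRich w := by
  induction w with
  | nil => simp [IsRichardsonFilling, fill, IsRich]
  | cons x w ih =>
    rw [isRichardsonFilling_cons, ih hw.1, IsRich]
    refine and_congr_right fun _ => ?_
    by_cases hx : x = 0
    · simp [hx]
    · have := (isYam_cons.1 hw).2.resolve_left hx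
      rw [forall_exists_iff_find hx (List.count_pos_iff.1 (by omega))]

/-- Standard tableaux fixed by evacuation that are Richardson correspond to Richardson words fixed
by evacuation. -/
theorem card_tableau_eq_card_word (n : ℕ) :
    Nat.card {T : StandardTableau n // T.IsRichardson ∧ T.IsEvacFixed} =
      Nat.card {w : List ℕ // w.length = n ∧ IsRich w ∧ evac n w = w} := by
  have hlen : ∀ m w, (evac m w).length = m := by
    intro m
    induction m with
    | zero => intro w; rfl
    | succ m ih => intro w; simp [evac, ih]
  have key : ∀ (T : StandardTableau n) {w : List ℕ}, IsYam w → w.length = n → fill w = T.filling →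
      (T.IsRichardson ∧ T.IsEvacFixed ↔ IsRich w ∧ evac n w = w) := by
    intro T w hw hl hf
    rw [T.isRichardson_iff, ← hf, isRichardsonFilling_fill hw, StandardTableau.IsEvacFixed, ← hf,
      ← hl, evacFilling_fill hw]
    exact and_congr_right fun _ => ⟨fun h => fill_injective (hlen _ _) h, fun h => by rw [h]⟩
  choose word h1 h2 h3 using fun T : StandardTableau n => exists_fill_eq T.isStandardFilling
  refine Nat.card_congr (Equiv.ofBijective
    (fun T => ⟨word T.1, h2 T.1, (key T.1 (h1 _) (h2 _) (h3 _)).1 T.2⟩) ⟨fun S T h => ?_, ?_⟩)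
  · refine Subtype.ext (StandardTableau.filling_injective ?_)
    rw [← h3, ← h3, show word S.1 = word T.1 from congrArg Subtype.val h]
  · rintro ⟨w, hl, hr, he⟩
    obtain ⟨T, hT⟩ := (hl ▸ isStandardFilling_fill hr.isYam).exists_filling_eq
    have hw : word T = w := fill_injective ((h2 T).trans hl.symm) ((h3 T).trans hT)
    exact ⟨⟨T, (key T hr.isYam hl hT.symm).2 ⟨hr, he⟩⟩, Subtype.ext hw⟩

end RowWord

/-! ### Counting paths by first passage -/

/-- The number of paths of length `n` from height `h` to height `0` that never go below the
axis. -/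
def pathCount : ℕ → ℕ → ℕ
  | h, 0 => if h = 0 then 1 else 0
  | 0, n + 1 => pathCount 0 n + pathCount 1 n
  | h + 1, n + 1 => pathCount (h + 1) n + pathCount (h + 2) n + pathCount h n

/-- The paths of length `n` from height `h` to height `0` that never go below the axis. -/
def pathsFrom : ℕ → ℕ → Finset (List SignType)
  | h, 0 => if h = 0 then {[]} else ∅
  | 0, n + 1 => (pathsFrom 0 n).image (List.cons .zero) ∪ (pathsFrom 1 n).image (List.cons .pos)
  | h + 1, n + 1 => ((pathsFrom (h + 1) n).image (List.cons .zero) ∪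
      (pathsFrom (h + 2) n).image (List.cons .pos)) ∪ (pathsFrom h n).image (List.cons .neg)

theorem card_pathsFrom (h n : ℕ) : (pathsFrom h n).card = pathCount h n := by
  induction n generalizing h with
  | zero =>
    unfold pathsFrom pathCount
    split_ifs <;> simp
  | succ n ih =>
    have hd : ∀ (s t : SignType) (A B : Finset (List SignType)), s ≠ t →
        Disjoint (A.image (List.cons s)) (B.image (List.cons t)) := by
      intro s t A B hst
      rw [Finset.disjoint_left]
      simp only [Finset.mem_image]
      rintro _ ⟨p, -, rfl⟩ ⟨q, -, hq⟩
      exact hst (List.cons_eq_cons.1 hq).1.symm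
    have hi : ∀ s : SignType, Function.Injective (List.cons s) := fun s => List.cons_injective
    cases h with
    | zero =>
      rw [pathsFrom, pathCount, Finset.card_union_of_disjoint (hd _ _ _ _ (by decide)),
        Finset.card_image_of_injective _ (hi _), Finset.card_image_of_injective _ (hi _), ih, ih]
    | succ h =>
      rw [pathsFrom, pathCount, Finset.card_union_of_disjoint
          (Finset.disjoint_union_left.2 ⟨hd _ _ _ _ (by decide), hd _ _ _ _ (by decide)⟩),
        Finset.card_union_of_disjoint (hd _ _ _ _ (by decide)),
        Finset.card_image_of_injective _ (hi _), Finset.card_image_of_injective _ (hi _),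
        Finset.card_image_of_injective _ (hi _), ih, ih, ih]

theorem mem_pathsFrom {h n : ℕ} {p : List SignType} :
    p ∈ pathsFrom h n ↔ p.length = n ∧ IsMotzkinPath h 0 p := by
  induction n generalizing h p with
  | zero =>
    unfold pathsFrom
    cases p with
    | nil => split_ifs <;> simp_all [IsMotzkinPath]
    | cons s p => split_ifs <;> simp
  | succ n ih =>
    cases h <;> cases p with
    | nil => simp [pathsFrom]
    | cons s p => cases s <;> simp [pathsFrom, IsMotzkinPath, ih]

theorem pathHeight_zero {n : ℕ} (s : Fin n → SignType) : pathHeight s 0 = 0 := by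
  simp [pathHeight]

theorem pathHeight_succ {n : ℕ} (s : Fin (n + 1) → SignType) (k : ℕ) :
    pathHeight s (k + 1) = s 0 + pathHeight (fun i => s i.succ) k := by
  simp [pathHeight, Fin.sum_univ_succ]

theorem isMotzkinPath_ofFn {n : ℕ} (s : Fin n → SignType) (h : ℕ) :
    IsMotzkinPath h 0 (List.ofFn s) ↔
      (∀ k : Fin (n + 1), 0 ≤ (h : ℤ) + pathHeight s k) ∧ (h : ℤ) + pathHeight s n = 0 := by
  induction n generalizing h with
  | zero =>
    simp [IsMotzkinPath, pathHeight_zero]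
  | succ n ih =>
    rw [List.ofFn_succ, Fin.forall_fin_succ, pathHeight_succ]
    simp only [Fin.val_zero, Fin.val_succ, pathHeight_zero, pathHeight_succ]
    rcases hs : s 0 with _ | _ | _
    · simp only [IsMotzkinPath, ih]
      simp
    · simp only [IsMotzkinPath, ih]
      cases h with
      | zero =>
        simp
        intro h0
        have := h0 0
        simp [pathHeight_zero] at this
      | succ h =>
        simp
        grind
    · simp only [IsMotzkinPath, ih]
      simp [add_assoc]

theorem motzkin_eq (n : ℕ) : motzkin n = pathCount 0 n := by
  rw [motzkin, ← card_pathsFrom]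
  refine Finset.card_bij (fun s _ => List.ofFn s) (fun s hs => ?_)
    (fun s _ t _ h => List.ofFn_injective h) (fun p hp => ?_)
  · have := (Finset.mem_filter.1 hs).2
    rw [mem_pathsFrom, isMotzkinPath_ofFn]
    simpa using this
  · obtain ⟨rfl, h⟩ := mem_pathsFrom.1 hp
    refine ⟨p.get, ?_, List.ofFn_get p⟩
    rw [← List.ofFn_get p, isMotzkinPath_ofFn] at h
    simpa using h

theorem pathCount_eq_zero {h n : ℕ} (hn : n < h) : pathCount h n = 0 := by
  induction n generalizing h with
  | zero => exact if_neg (by omega)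
  | succ n ih =>
    obtain ⟨h, rfl⟩ : ∃ h', h = h' + 1 := ⟨h - 1, by omega⟩
    rw [pathCount, ih (by omega), ih (by omega), ih (by omega)]

/-- First passage decomposition. -/
theorem pathCount_add_succ (a b n : ℕ) : pathCount (a + b + 1) (n + 1) =
    ∑ x ∈ Finset.HasAntidiagonal.antidiagonal n, pathCount a x.1 * pathCount b x.2 := by
  induction n generalizing a with
  | zero =>
    rw [pathCount]
    simp [pathCount]
    split_ifs <;> omega
  | succ n ih =>
    have e : pathCount (a + b + 1) (n + 1 + 1) = pathCount (a + b + 1) (n + 1) +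
      pathCount (a + b + 2) (n + 1) + pathCount (a + b) (n + 1) := rfl
    -- The term split off has an empty first part: it is an immediate down step to height b,
    -- possible only for a = 0.
    rw [Finset.Nat.sum_antidiagonal_succ, e]
    cases a with
    | zero =>
      have h1 := ih 0
      have h2 := ih 1
      rw [show 1 + b + 1 = 0 + b + 2 by omega] at h2
      rw [h1, h2, zero_add]
      simp only [pathCount, add_mul, Finset.sum_add_distrib, if_true, one_mul]
      ring
    | succ a =>
      have h1 := ih (a + 1)
      have h2 := ih (a + 2)
      have h3 := ih a
      rw [show a + 2 + b + 1 = a + 1 + b + 2 by omega] at h2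
      rw [show a + b + 1 = a + 1 + b by omega] at h3
      rw [h1, h2, h3]
      simp only [pathCount, add_mul, Finset.sum_add_distrib]
      simp

/-- Used for the fact that a path from height k down to 0 has at least k steps. -/
theorem sum_antidiagonal_add (s k : ℕ) (f : ℕ → ℕ → ℕ) (hf : ∀ i j, j < k → f i j = 0) :
    ∑ x ∈ Finset.HasAntidiagonal.antidiagonal (s + k), f x.1 x.2 =
      ∑ x ∈ Finset.HasAntidiagonal.antidiagonal s, f x.1 (x.2 + k) := by
  induction k generalizing f with
  | zero => rfl
  | succ k ih =>
    rw [← add_assoc, Finset.Nat.sum_antidiagonal_succ', hf _ 0 (by omega), zero_add,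
      ih (fun i j => f i (j + 1)) fun i j hj => hf i (j + 1) (by omega)]
    rfl

theorem sum_antidiagonalTuple_succ (k n : ℕ) (F : (Fin (k + 1) → ℕ) → ℕ) :
    ∑ a ∈ Finset.Nat.antidiagonalTuple (k + 1) n, F a = ∑ x ∈ Finset.HasAntidiagonal.antidiagonal n,
      ∑ b ∈ Finset.Nat.antidiagonalTuple k x.2, F (Fin.cons x.1 b) := by
  rw [Finset.sum_sigma']
  refine Finset.sum_nbij' (fun a => ⟨(a 0, ∑ p, Fin.tail a p), Fin.tail a⟩)
    (fun y => Fin.cons y.1.1 y.2) ?_ ?_ ?_ ?_ ?_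
  · intro a ha
    rw [Finset.Nat.mem_antidiagonalTuple, Fin.sum_univ_succ] at ha
    simp only [Finset.mem_sigma, Finset.HasAntidiagonal.mem_antidiagonal,
      Finset.Nat.mem_antidiagonalTuple, and_true]
    exact ha
  · rintro ⟨⟨i, j⟩, b⟩ h
    simp only [Finset.mem_sigma, Finset.HasAntidiagonal.mem_antidiagonal,
      Finset.Nat.mem_antidiagonalTuple] at h
    rw [Finset.Nat.mem_antidiagonalTuple, Fin.sum_univ_succ]
    simpa [h.2] using h.1
  · intro a _
    exact Fin.cons_self_tail a
  · rintro ⟨⟨i, j⟩, b⟩ h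
    simp only [Finset.mem_sigma, Finset.HasAntidiagonal.mem_antidiagonal,
      Finset.Nat.mem_antidiagonalTuple] at h
    simp [h.2]
  · intro a _
    rw [Fin.cons_self_tail]

/-- The k first-passage down steps of a path from height k cut it into k + 1 Motzkin paths of total
length s. -/
theorem sum_antidiagonalTuple_prod_pathCount (k s : ℕ) :
    ∑ a ∈ Finset.Nat.antidiagonalTuple (k + 1) s, ∏ p, pathCount 0 (a p) = pathCount k (s + k) := by
  induction k generalizing s with
  | zero => simp
  | succ k ih =>
    have h1 := pathCount_add_succ 0 k (s + k)
    rw [zero_add] at h1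
    rw [← add_assoc, h1, sum_antidiagonal_add s k (fun i j => pathCount 0 i * pathCount k j)
      fun i j hj => by rw [pathCount_eq_zero hj, mul_zero]]
    rw [sum_antidiagonalTuple_succ]
    refine Finset.sum_congr rfl fun x _ => ?_
    simp only [Fin.prod_univ_succ, Fin.cons_zero, Fin.cons_succ, ← Finset.mul_sum]
    rw [← ih]
    simp only [Fin.prod_univ_succ]

/-! ### Symmetric paths and their second halves -/

theorem IsMotzkinPath.start_unique {a b c : ℕ} {p : List SignType} (h : IsMotzkinPath a c p)
    (h' : IsMotzkinPath b c p) : a = b := by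
  induction p generalizing a b with
  | nil => exact Eq.trans h (Eq.symm h')
  | cons s p ih =>
    cases s
    · exact ih (a := a) (b := b) h h'
    · obtain ⟨a, rfl, h⟩ := h
      obtain ⟨b, rfl, h'⟩ := h'
      rw [ih h h']
    · exact Nat.succ_injective (ih (a := a + 1) (b := b + 1) h h')

theorem IsMotzkinPath.start_le {a : ℕ} {p : List SignType} (h : IsMotzkinPath a 0 p) :
    a ≤ p.length := by
  induction p generalizing a with
  | nil => exact Nat.le_of_eq h
  | cons s p ih =>
    rw [List.length_cons]
    cases s
    · exact (ih (a := a) h).trans (Nat.le_succ _)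
    · obtain ⟨a, rfl, h⟩ := h
      exact Nat.succ_le_succ (ih h)
    · have := ih (a := a + 1) h
      omega

theorem card_suffixes (m : ℕ) :
    Nat.card {q : List SignType // q.length = m ∧ ∃ h, IsMotzkinPath h 0 q} =
      ∑ h ∈ Finset.range (m + 1), pathCount h m := by
  simp only [← card_pathsFrom]
  rw [← Finset.card_biUnion]
  · refine Nat.subtype_card _ fun q => ?_
    simp only [Finset.mem_biUnion, Finset.mem_range, mem_pathsFrom]
    constructor
    · rintro ⟨h, -, h1, h2⟩
      exact ⟨h1, h, h2⟩
    · rintro ⟨h1, h, h2⟩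
      exact ⟨h, by have := h2.start_le; omega, h1, h2⟩
  · intro h _ h' _ hne
    refine Finset.disjoint_left.2 fun q h1 h2 => hne ?_
    exact (mem_pathsFrom.1 h1).2.start_unique (mem_pathsFrom.1 h2).2

/-- The first half of a symmetric path is determined by the second half. -/
theorem card_symmetric_paths (n : ℕ) :
    Nat.card {p : List SignType // p.length = n ∧ IsMotzkinPath 0 0 p ∧ reversePath p = p} =
      Nat.card {q : List SignType // q.length = n / 2 ∧ ∃ h, IsMotzkinPath h 0 q} := by
  have hz : ∀ r h, IsMotzkinPath h h (List.replicate r SignType.zero) := by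
    intro r h
    induction r with
    | zero => rfl
    | succ r ih => exact ih
  have hlen : ∀ q : List SignType, q.length = n / 2 →
      (reversePath q ++ (List.replicate (n % 2) SignType.zero ++ q)).length = n := by
    intro q hq
    simp only [List.length_append, length_reversePath, List.length_replicate, hq]
    omega
  symm
  refine Nat.card_congr (Equiv.ofBijective
    (fun q => ⟨reversePath q.1 ++ (List.replicate (n % 2) SignType.zero ++ q.1), hlen _ q.2.1,
      ?_, ?_⟩)
    ⟨?_, ?_⟩)
  · obtain ⟨q, -, h, hq⟩ := q
    exact isMotzkinPath_append.2 ⟨h, hq.reverse, isMotzkinPath_append.2 ⟨h, hz _ _, hq⟩⟩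
  · have : reversePath (List.replicate (n % 2) SignType.zero) =
        List.replicate (n % 2) SignType.zero := by
      simp [reversePath]
    rw [reversePath_append, reversePath_append, reversePath_reversePath, this, List.append_assoc]
  · rintro ⟨q, hq, _⟩ ⟨r, hr, _⟩ h
    have h := congrArg Subtype.val h
    simp only [← List.append_assoc] at h
    exact Subtype.ext (List.append_inj_right' h (hq.trans hr.symm))
  · rintro ⟨p, hl, hp, hs⟩
    obtain ⟨u, c, q, rfl, hq, hc, hu⟩ : ∃ u c q, p = u ++ (c ++ q) ∧ q.length = n / 2 ∧
        c.length = n % 2 ∧ u.length = n / 2 := by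
      refine ⟨p.take (n / 2), (p.drop (n / 2)).take (n % 2), (p.drop (n / 2)).drop (n % 2), ?_, ?_⟩
      · rw [List.take_append_drop, List.take_append_drop]
      · simp only [List.length_drop, List.length_take, hl]
        omega
    rw [reversePath_append, reversePath_append, List.append_assoc] at hs
    obtain ⟨h1, h2⟩ := List.append_inj hs (by rw [length_reversePath, hq, hu])
    have h3 := List.append_inj_left h2 (length_reversePath c)
    -- A middle step equals its own negative, so it is flat.
    have hc' : c = List.replicate (n % 2) SignType.zero := by
      rw [← hc]
      have : n % 2 < 2 := Nat.mod_lt _ two_pos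
      match c, hc, h3 with
      | [], _, _ => rfl
      | [s], _, h3 =>
        cases s <;> simp [reversePath] at h3 ⊢
      | _ :: _ :: _, hc, _ => simp at hc; omega
    obtain ⟨a, -, ha⟩ := isMotzkinPath_append.1 hp
    obtain ⟨b, -, hb⟩ := isMotzkinPath_append.1 ha
    subst hc' h1
    exact ⟨⟨q, hq, b, hb⟩, rfl⟩

/-- Both sides count the Motzkin structures fixed by `rev`. -/
theorem card_word_eq_card_path (n : ℕ) :
    Nat.card {w : List ℕ // w.length = n ∧ RowWord.IsRich w ∧ RowWord.evac n w = w} =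
      Nat.card {p : List SignType // p.length = n ∧ IsMotzkinPath 0 0 p ∧ reversePath p = p} := by
  trans Nat.card {t : MotzkinTree // t.word.length = n ∧ t.rev = t}
  · symm
    refine Nat.card_congr (Equiv.ofBijective (fun t => ⟨t.1.word, t.2.1, t.1.isRich_word, ?_⟩)
      ⟨?_, ?_⟩)
    · obtain ⟨t, rfl, ht⟩ := t
      exact t.evac_word.trans (congrArg _ ht)
    · intro s t h
      exact Subtype.ext (MotzkinTree.word_injective (congrArg Subtype.val h))
    · rintro ⟨w, rfl, hw, he⟩
      obtain ⟨t, rfl⟩ := MotzkinTree.exists_word_eq hw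
      exact ⟨⟨t, rfl, MotzkinTree.word_injective (by rw [← t.evac_word, he])⟩, rfl⟩
  · refine Nat.card_congr (Equiv.ofBijective
      (fun t => ⟨t.1.path, t.1.length_path.trans t.2.1, t.1.isMotzkinPath_path, ?_⟩) ⟨?_, ?_⟩)
    · rw [← t.1.path_rev, t.2.2]
    · intro s t h
      exact Subtype.ext (MotzkinTree.path_injective (congrArg Subtype.val h))
    · rintro ⟨p, rfl, hp, hr⟩
      obtain ⟨t, rfl⟩ := MotzkinTree.exists_path_eq hp
      exact ⟨⟨t, t.length_path.symm, MotzkinTree.path_injective (by rw [t.path_rev, hr])⟩, rfl⟩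

/-! ### Index chains and the final count -/

/-- Index chains correspond to the sequences of their gaps. -/
theorem sum_indexChains {m k : ℕ} (hk : k ≤ m) (F : (Fin (k + 1) → ℕ) → ℕ) :
    ∑ i ∈ indexChains m k, F (fun p => (i p.succ : ℕ) - (i p.castSucc : ℕ) - 1) =
      ∑ a ∈ Finset.Nat.antidiagonalTuple (k + 1) (m - k), F a := by
  have hlast : ∀ a : Fin (k + 1) → ℕ,
      Fin.partialSum (fun q => a q + 1) (Fin.last (k + 1)) = ∑ q, a q + (k + 1) := by
    intro a
    simp [Fin.partialSum, List.sum_ofFn, Finset.sum_add_distrib, List.take_of_length_le,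
      Fin.sum_univ_succ]
    omega
  -- Each index is the sum of the earlier gaps, plus one for each; strict increase makes the
  -- truncated subtractions exact.
  have key : ∀ i ∈ indexChains m k, ∀ p, (i p : ℕ) =
      Fin.partialSum (fun q : Fin (k + 1) => (i q.succ : ℕ) - (i q.castSucc : ℕ) - 1 + 1) p := by
    intro i hi p
    obtain ⟨h0, -, hlt⟩ := (Finset.mem_filter.1 hi).2
    induction p using Fin.induction with
    | zero => simp [h0]
    | succ p ih =>
      have := Fin.lt_def.1 (hlt p)
      rw [Fin.partialSum_succ, ← ih]
      omega
  refine Finset.sum_nbij (fun i p => (i p.succ : ℕ) - (i p.castSucc : ℕ) - 1) ?_ ?_ ?_ ?_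
  · intro i hi
    have h1 := key i hi (Fin.last _)
    rw [hlast (fun q => (i q.succ : ℕ) - (i q.castSucc : ℕ) - 1),
      (Finset.mem_filter.1 hi).2.2.1, Fin.val_last] at h1
    rw [Finset.Nat.mem_antidiagonalTuple]
    omega
  · intro i hi j hj h
    funext p
    refine Fin.ext ?_
    rw [key i hi, key j hj]
    refine congrArg (fun a : Fin (k + 1) → ℕ => Fin.partialSum (fun q => a q + 1) p) h
  · intro a ha
    have ha := Finset.Nat.mem_antidiagonalTuple.1 ha
    have hmono : Monotone (Fin.partialSum (fun q => a q + 1)) :=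
      Fin.monotone_iff_le_succ.2 fun q => by
        rw [Fin.partialSum_succ]
        omega
    -- This needs k ≤ m, so that m - k is a true difference.
    have hl : Fin.partialSum (fun q => a q + 1) (Fin.last (k + 1)) = m + 1 := by
      rw [hlast, ha]
      omega
    refine ⟨fun p => ⟨Fin.partialSum (fun q => a q + 1) p, ?_⟩, ?_, ?_⟩
    · have := hmono (Fin.le_last p)
      omega
    · refine Finset.mem_coe.2 (Finset.mem_filter.2 ⟨Finset.mem_univ _, ?_, ?_, fun p => ?_⟩)
      · exact Fin.ext (by simp)
      · exact Fin.ext hl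
      · rw [Fin.lt_def]
        simp only [Fin.partialSum_succ]
        omega
    · funext p
      simp only [Fin.partialSum_succ]
      omega
  · intro i _
    rfl

theorem mainTheorem4 (n : ℕ) :
    Nat.card {T : StandardTableau n // T.IsRichardson ∧ T.IsEvacFixed} =
      motzkin (n / 2) +
        ∑ k ∈ Finset.Icc 1 (n / 2), ∑ i ∈ indexChains (n / 2) k,
          ∏ p : Fin (k + 1), motzkin ((i p.succ : ℕ) - (i p.castSucc : ℕ) - 1) := by
  -- The summation index k is the height at the middle of the symmetric path; height 0 is split off
  -- as the leading Motzkin number.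
  rw [RowWord.card_tableau_eq_card_word, card_word_eq_card_path, card_symmetric_paths,
    card_suffixes, Finset.sum_range_succ', add_comm, motzkin_eq, Finset.range_eq_Ico,
    Finset.sum_Ico_add' (fun k => pathCount k (n / 2)) 0 (n / 2) 1]
  congr 1
  refine Finset.sum_congr rfl fun k hk => ?_
  have hk := (Finset.mem_Icc.1 hk).2
  simp only [motzkin_eq]
  rw [sum_indexChains hk (fun a => ∏ p, pathCount 0 (a p)), sum_antidiagonalTuple_prod_pathCount,
    Nat.sub_add_cancel hk]
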